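/- Let $\nu>0$ and $T>0$, let $H=L^2(\mathbb R)$ and $V=H^1(\mathbb R)$ with $\|v\|_V^2=\|v\|_H^2+\|\partial_x v\|_H^2$, and let $V^*$ be the dual of $V$, where $V\hookrightarrow H=H^*\hookrightarrow V^*$. Let $$W(V)=\{y\in L^2(0,T;V) : \partial_t y\in L^2(0,T;V^*)\},\qquad \|y\|_{W(V)}^2=\|y\|_{L^2(0,T;V)}^2+\|\partial_t y\|_{L^2(0,T;V^*)}^2 ,$$ and for $y\in W(V)$ let $y(T)\in H$ be the value at $T$ of the representative of $y$ in $C([0,T];H)$. Fix $y_d\in H$. For $y\in W(V)$ let $p=p(y)\in W(V)$ denote the solution of the adjoint equation $$\langle \partial_t p(t),\phi\rangle_{V^*,V}+\langle y(t)\,\partial_x p(t),\phi\rangle_H-\nu\,\langle\partial_x p(t),\partial_x\phi\rangle_H=0\quad\text{for all }\phi\in V\text{ and a.e. }t\in(0,T),$$ $$\langle p(T),\psi\rangle_H=\langle y_d-y(T),\psi\rangle_H\quad\text{for all }\psi\in H .$$ Then the adjoint solution map $y\mapsto p(y)$ is Lipschitz on bounded sets: for every $M$ there is a constant $C$, depending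 only on $\nu$, $T$, $y_d$ and $M$, such that $$\|p(y_1)-p(y_2)\|_{L^2(0,T;V)}\le C\,\|y_1-y_2\|_{W(V)}$$ for all $y_1,y_2\in W(V)$ (and all solutions $p(y_1),p(y_2)\in W(V)$ of the corresponding adjoint equations) such that each $y_i$ satisfies $\|y_i\|_{L^\infty(0,T;V)}\le M$ or $\|y_i\|_{W(V)}\le M$. -/

import Mathlib

open MeasureTheory Set Filter Topology
open scoped ContDiff ENNReal

noncomputable section

namespace BurgersAdjoint

/-- The space `H = L²(ℝ)`. -/
abbrev H : Type := Lp ℝ 2 (volume : Measure ℝ)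

/-- `g` is the weak derivative of `u` on `ℝ`, for `u, g ∈ L²(ℝ)`. -/
def HasWeakDeriv (u g : H) : Prop :=
  ∀ η : ℝ → ℝ, ContDiff ℝ ∞ η → HasCompactSupport η →
    ∫ x, u x * deriv η x = - ∫ x, g x * η x

theorem integrable_mul_test (u : H) {η : ℝ → ℝ} (hc : Continuous η)
    (hs : HasCompactSupport η) : Integrable (fun x => u x * η x) :=
  MemLp.integrable_mul (p := 2) (q := 2) (Lp.memLp u) (hc.memLp_of_hasCompactSupport hs)

theorem HasWeakDeriv.zero : HasWeakDeriv 0 0 := by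
  intro η _ _
  have h : ((0 : H) : ℝ → ℝ) =ᵐ[volume] 0 := Lp.coeFn_zero ℝ 2 volume
  rw [integral_eq_zero_of_ae (h.mono fun x hx => by simp only [hx, Pi.zero_apply, zero_mul]),
    integral_eq_zero_of_ae (h.mono fun x hx => by simp only [hx, Pi.zero_apply, zero_mul]), neg_zero]

theorem HasWeakDeriv.add {u v g k : H} (hu : HasWeakDeriv u g) (hv : HasWeakDeriv v k) :
    HasWeakDeriv (u + v) (g + k) := by
  intro η hη hs
  have hη' : Continuous (deriv η) := hη.continuous_deriv (by simp)
  have e1 : ∫ x, (u + v : H) x * deriv η x = ∫ x, (u x * deriv η x + v x * deriv η x) :=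
    integral_congr_ae ((Lp.coeFn_add u v).mono fun x hx => by simp only [hx, Pi.add_apply, add_mul])
  have e2 : ∫ x, (g + k : H) x * η x = ∫ x, (g x * η x + k x * η x) :=
    integral_congr_ae ((Lp.coeFn_add g k).mono fun x hx => by simp only [hx, Pi.add_apply, add_mul])
  rw [e1, e2, integral_add (integrable_mul_test u hη' hs.deriv)
    (integrable_mul_test v hη' hs.deriv), integral_add (integrable_mul_test g hη.continuous hs)
    (integrable_mul_test k hη.continuous hs), hu η hη hs, hv η hη hs]
  ring

theorem HasWeakDeriv.smul {u g : H} (c : ℝ) (hu : HasWeakDeriv u g) :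
    HasWeakDeriv (c • u) (c • g) := by
  intro η hη hs
  have e1 : ∫ x, (c • u : H) x * deriv η x = ∫ x, c * (u x * deriv η x) :=
    integral_congr_ae ((Lp.coeFn_smul c u).mono fun x hx => by
      simp only [hx, Pi.smul_apply, smul_eq_mul, mul_assoc])
  have e2 : ∫ x, (c • g : H) x * η x = ∫ x, c * (g x * η x) :=
    integral_congr_ae ((Lp.coeFn_smul c g).mono fun x hx => by
      simp only [hx, Pi.smul_apply, smul_eq_mul, mul_assoc])
  rw [e1, e2, integral_const_mul, integral_const_mul, hu η hη hs]
  ring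

/-- The graph `{(u, u') : u ∈ H¹(ℝ)}` inside the Hilbert space `L²(ℝ) × L²(ℝ)`. -/
def sobolevGraph : Submodule ℝ (WithLp 2 (H × H)) where
  carrier := {v | HasWeakDeriv v.fst v.snd}
  zero_mem' := HasWeakDeriv.zero
  add_mem' := fun ha hb => HasWeakDeriv.add ha hb
  smul_mem' := fun c _ ha => HasWeakDeriv.smul c ha

/-- The space `V = H¹(ℝ)`; the weak derivative is carried along with the function, and the norm
is `‖v‖_V² = ‖v‖_H² + ‖∂ₓ v‖_H²`. -/
def V : Type := sobolevGraph

instance : NormedAddCommGroup V := Submodule.normedAddCommGroup sobolevGraph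

instance : InnerProductSpace ℝ V := Submodule.innerProductSpace sobolevGraph

/-- The embedding `V ↪ H`. -/
def V.val : V →L[ℝ] H := (WithLp.fstL 2 ℝ H H).comp sobolevGraph.subtypeL

/-- The spatial weak derivative `∂ₓ : V → H`. -/
def V.dx : V →L[ℝ] H := (WithLp.sndL 2 ℝ H H).comp sobolevGraph.subtypeL

/-- The dual space `V*` with the operator norm. -/
abbrev VDual : Type := StrongDual ℝ V

/-- Lebesgue measure on the time interval `(0, T)`. -/
abbrev timeMeasure (T : ℝ) : Measure ℝ := volume.restrict (Ioo 0 T)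

/-- The Bochner space `L²(0, T; V)`. -/
abbrev L2V (T : ℝ) : Type := Lp V 2 (timeMeasure T)

/-- The Bochner space `L²(0, T; V*)`. -/
abbrev L2VDual (T : ℝ) : Type := Lp VDual 2 (timeMeasure T)

/-- `g = ∂ₜ y` in the sense of `V*`-valued distributions on `(0, T)`, where `V ⊂ V*` through the
inner product of `H`. -/
def HasTimeDeriv (T : ℝ) (y : L2V T) (g : L2VDual T) : Prop :=
  ∀ η : ℝ → ℝ, ContDiff ℝ ∞ η → HasCompactSupport η → tsupport η ⊆ Ioo 0 T → ∀ φ : V,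
    ∫ t in Ioo 0 T, deriv η t * inner ℝ (V.val (y t)) (V.val φ)
      = - ∫ t in Ioo 0 T, η t * g t φ

theorem integrable_test_mul {E : Type*} [NormedAddCommGroup E] [NormedSpace ℝ E] {T : ℝ}
    (f : Lp E 2 (timeMeasure T)) (L : E →L[ℝ] ℝ) {η : ℝ → ℝ} (hc : Continuous η)
    (hs : HasCompactSupport η) :
    Integrable (fun t => η t * L (f t)) (timeMeasure T) :=
  MemLp.integrable_mul (p := 2) (q := 2) (hc.memLp_of_hasCompactSupport hs)
    (L.comp_memLp' (Lp.memLp f))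

/-- `v ↦ ⟨v, φ⟩_H` as a functional on `V`. -/
def pairH (φ : V) : V →L[ℝ] ℝ := (innerSL ℝ (V.val φ)).comp V.val

theorem pairH_apply (φ v : V) : pairH φ v = inner ℝ (V.val v) (V.val φ) := by
  simp only [pairH, ContinuousLinearMap.comp_apply, innerSL_apply_apply]
  exact real_inner_comm _ _

/-- `f ↦ ⟨f, φ⟩_{V*, V}` as a functional on `V*`. -/
def evalAt (φ : V) : VDual →L[ℝ] ℝ := ContinuousLinearMap.apply ℝ ℝ φ

theorem hasTimeDeriv_iff {T : ℝ} {y : L2V T} {g : L2VDual T} :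
    HasTimeDeriv T y g ↔ ∀ η : ℝ → ℝ, ContDiff ℝ ∞ η → HasCompactSupport η →
      tsupport η ⊆ Ioo 0 T → ∀ φ : V,
      ∫ t in Ioo 0 T, deriv η t * pairH φ (y t) = - ∫ t in Ioo 0 T, η t * evalAt φ (g t) := by
  simp only [HasTimeDeriv, pairH_apply]
  rfl

theorem HasTimeDeriv.zero (T : ℝ) : HasTimeDeriv T 0 0 := by
  rw [hasTimeDeriv_iff]
  intro η _ _ _ φ
  have h1 : ((0 : L2V T) : ℝ → V) =ᵐ[timeMeasure T] 0 := Lp.coeFn_zero V 2 _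
  have h2 : ((0 : L2VDual T) : ℝ → VDual) =ᵐ[timeMeasure T] 0 := Lp.coeFn_zero VDual 2 _
  rw [integral_eq_zero_of_ae (h1.mono fun x hx => by simp only [hx, Pi.zero_apply, map_zero, mul_zero]),
    integral_eq_zero_of_ae (h2.mono fun x hx => by simp only [hx, Pi.zero_apply, map_zero, mul_zero]), neg_zero]

theorem HasTimeDeriv.add {T : ℝ} {y z : L2V T} {g k : L2VDual T} (hy : HasTimeDeriv T y g)
    (hz : HasTimeDeriv T z k) : HasTimeDeriv T (y + z) (g + k) := by
  rw [hasTimeDeriv_iff] at *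
  intro η hη hs ht φ
  have hη' : Continuous (deriv η) := hη.continuous_deriv (by simp)
  have e1 : ∫ t in Ioo 0 T, deriv η t * pairH φ ((y + z : L2V T) t)
      = ∫ t in Ioo 0 T, (deriv η t * pairH φ (y t) + deriv η t * pairH φ (z t)) :=
    integral_congr_ae ((Lp.coeFn_add y z).mono fun x hx => by simp only [hx, Pi.add_apply, map_add, mul_add])
  have e2 : ∫ t in Ioo 0 T, η t * evalAt φ ((g + k : L2VDual T) t)
      = ∫ t in Ioo 0 T, (η t * evalAt φ (g t) + η t * evalAt φ (k t)) :=
    integral_congr_ae ((Lp.coeFn_add g k).mono fun x hx => by simp only [hx, Pi.add_apply, map_add, mul_add])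
  rw [e1, e2, integral_add (integrable_test_mul y _ hη' hs.deriv)
    (integrable_test_mul z _ hη' hs.deriv),
    integral_add (integrable_test_mul g _ hη.continuous hs)
    (integrable_test_mul k _ hη.continuous hs), hy η hη hs ht φ, hz η hη hs ht φ]
  ring

theorem HasTimeDeriv.smul {T : ℝ} {y : L2V T} {g : L2VDual T} (c : ℝ)
    (hy : HasTimeDeriv T y g) : HasTimeDeriv T (c • y) (c • g) := by
  rw [hasTimeDeriv_iff] at *
  intro η hη hs ht φ
  have e1 : ∫ t in Ioo 0 T, deriv η t * pairH φ ((c • y : L2V T) t)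
      = ∫ t in Ioo 0 T, c * (deriv η t * pairH φ (y t)) :=
    integral_congr_ae ((Lp.coeFn_smul c y).mono fun x hx => by
      simp only [hx, Pi.smul_apply, map_smul, smul_eq_mul, mul_left_comm])
  have e2 : ∫ t in Ioo 0 T, η t * evalAt φ ((c • g : L2VDual T) t)
      = ∫ t in Ioo 0 T, c * (η t * evalAt φ (g t)) :=
    integral_congr_ae ((Lp.coeFn_smul c g).mono fun x hx => by
      simp only [hx, Pi.smul_apply, map_smul, smul_eq_mul, mul_left_comm])
  rw [e1, e2, integral_const_mul, integral_const_mul, hy η hη hs ht φ]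
  ring

/-- The graph `{(y, ∂ₜ y)}` inside `L²(0, T; V) × L²(0, T; V*)`. -/
def evolutionGraph (T : ℝ) : Submodule ℝ (WithLp 2 (L2V T × L2VDual T)) where
  carrier := {y | HasTimeDeriv T y.fst y.snd}
  zero_mem' := HasTimeDeriv.zero T
  add_mem' := fun ha hb => HasTimeDeriv.add ha hb
  smul_mem' := fun c _ ha => HasTimeDeriv.smul c ha

/-- The space `W(V) = {y ∈ L²(0, T; V) : ∂ₜ y ∈ L²(0, T; V*)}`; the time derivative is carried
along, and `‖y‖_{W(V)}² = ‖y‖²_{L²(V)} + ‖∂ₜ y‖²_{L²(V*)}`. -/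
def W (T : ℝ) : Type := evolutionGraph T

instance (T : ℝ) : NormedAddCommGroup (W T) := Submodule.normedAddCommGroup (evolutionGraph T)

instance (T : ℝ) : NormedSpace ℝ (W T) := Submodule.normedSpace (evolutionGraph T)

/-- The element of `L²(0, T; V)` underlying `y ∈ W(V)`. -/
def W.toL2V {T : ℝ} (y : W T) : L2V T := y.1.fst

/-- The time derivative `∂ₜ y ∈ L²(0, T; V*)` of `y ∈ W(V)`. -/
def W.dt {T : ℝ} (y : W T) : L2VDual T := y.1.snd

/-- `Y` is a representative of `y` in `C([0, T]; H)`. -/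
def IsContRep {T : ℝ} (y : W T) (Y : ℝ → H) : Prop :=
  ContinuousOn Y (Icc 0 T) ∧ ∀ᵐ t ∂(timeMeasure T), Y t = V.val (y.toL2V t)

open Classical in
/-- The value `y(t) ∈ H` at `t ∈ [0, T]` of (the continuous representative of) `y ∈ W(V)`. -/
def W.valueAt {T : ℝ} (y : W T) (t : ℝ) : H :=
  if h : ∃ Y : ℝ → H, IsContRep y Y then h.choose t else 0

/-- The norm of `L^∞(0, T; V)`, with value `∞` if `y` is not essentially bounded. -/
def W.normLinftyV {T : ℝ} (y : W T) : ℝ≥0∞ := eLpNorm y.toL2V ∞ (timeMeasure T)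

/-- `p ∈ W(V)` is a solution of the adjoint equation with state `y`:
`d/dt ⟨p(t), φ⟩_H + ⟨y(t) ∂ₓ p(t), φ⟩_H - ν ⟨∂ₓ p(t), ∂ₓ φ⟩_H = 0` for all `φ ∈ V` and almost
every `t ∈ (0, T)`, and `⟨p(T), ψ⟩_H = ⟨y_d - y(T), ψ⟩_H` for all `ψ ∈ H`. -/
structure IsAdjointSolution (ν T : ℝ) (y_d : H) (y p : W T) : Prop where
  equation : ∀ φ : V, ∀ᵐ t ∂(timeMeasure T),
    p.dt t φ + (∫ x, V.val (y.toL2V t) x * V.dx (p.toL2V t) x * V.val φ x)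
      - ν * inner ℝ (V.dx (p.toL2V t)) (V.dx φ) = 0
  terminal : ∀ ψ : H, inner ℝ (p.valueAt T) ψ = inner ℝ (y_d - y.valueAt T) ψ

end BurgersAdjoint

end

/-!
The difference `q = p₁ - p₂` of two adjoint solutions solves the adjoint equation with transport
velocity `y₁`, source `(y₁ - y₂) ∂ₓ p₂` and terminal value `y₂(T) - y₁(T)`. Testing this equation
with `q` itself and using `H¹(ℝ) ⊂ L^∞(ℝ)` and Young's inequality gives
`d/dt ‖q‖_H² ≥ ν ‖∂ₓ q‖_H² - (4 ν⁻¹ ‖y₁‖_V² + 4 ‖p₂‖_V²) ‖q‖_H² - ‖y₁ - y₂‖_V²`.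
The coefficient of `‖q‖_H²` is integrable in time, so Gronwall's inequality, run backward from `T`,
bounds `q` in `L²(0, T; V)` in terms of `‖y₁ - y₂‖` and `‖(y₁ - y₂)(T)‖`. The same estimate, with
zero source, bounds `p₂` in terms of `y_d` and `y₂`.

Testing with `q` rests on the energy identity `‖q(t)‖² - ‖q(s)‖² = 2 ∫ ⟨∂ₜ q, q⟩`. With
`τ_h q = q(· + h)`, symmetry of the pivot embedding turns `‖τ_h q‖² - ‖q‖²` into the pairing of
`τ_h q - q = ∫_0^h τ_r ∂ₜ q dr` with `τ_h q + q`, and translation is continuous in `L²`, so dividing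
by `h` and letting `h → 0` gives the identity.
-/

noncomputable section

namespace BurgersAdjoint

section WeakDerivative

/-- A test function on the open set `U ⊆ ℝ`: an element of `C_c^∞(U)`, extended by zero. -/
structure IsTestFunction (U : Set ℝ) (η : ℝ → ℝ) : Prop where
  contDiff : ContDiff ℝ ∞ η
  hasCompactSupport : HasCompactSupport η
  tsupport_subset : tsupport η ⊆ U

variable {E : Type*} [NormedAddCommGroup E] [NormedSpace ℝ E] {U : Set ℝ} {a b : ℝ} {η θ : ℝ → ℝ}
  {f g : ℝ → E}

theorem intervalIntegral_eq_zero_of_notMem_Icc {α β t : ℝ} (hα : a < α)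
    (hsub : tsupport θ ⊆ Icc α β) (h0 : ∫ s, θ s = 0) (ht : t ∉ Icc α β) :
    ∫ s in a..t, θ s = 0 := by
  have hzero : ∀ s ∉ Icc α β, θ s = 0 := fun s hs =>
    image_eq_zero_of_notMem_tsupport fun h => hs (hsub h)
  rcases lt_or_ge t α with htα | hαt
  · refine intervalIntegral.integral_zero_ae (Eventually.of_forall fun s hs => hzero s fun h => ?_)
    exact (h.1.trans hs.2).not_gt (max_lt hα htα)
  · have hβt : β < t := not_le.1 fun h => ht ⟨hαt, h⟩
    rw [intervalIntegral.integral_eq_integral_of_support_subset, h0]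
    exact fun s hs => have h := hsub (subset_tsupport θ hs)
      ⟨hα.trans_le h.1, h.2.trans hβt.le⟩

namespace IsTestFunction

theorem continuous (hη : IsTestFunction U η) : Continuous η := hη.contDiff.continuous

theorem eq_zero_of_notMem (hη : IsTestFunction U η) {t : ℝ} (ht : t ∉ U) : η t = 0 :=
  image_eq_zero_of_notMem_tsupport fun h => ht (hη.tsupport_subset h)

theorem integrable (hη : IsTestFunction U η) : Integrable η :=
  hη.continuous.integrable_of_hasCompactSupport hη.hasCompactSupport

theorem integrableOn_smul (hη : IsTestFunction U η) (hf : IntegrableOn f U) :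
    IntegrableOn (fun t => η t • f t) U := by
  obtain ⟨C, hC⟩ := hη.continuous.bounded_above_of_compact_support hη.hasCompactSupport
  exact hf.bdd_smul C hη.continuous.aestronglyMeasurable (Eventually.of_forall hC)

theorem setIntegral_smul (hη : IsTestFunction U η) (f : ℝ → E) :
    ∫ t in U, η t • f t = ∫ t, η t • f t :=
  setIntegral_eq_integral_of_forall_compl_eq_zero fun t ht => by
    rw [hη.eq_zero_of_notMem ht, zero_smul]

theorem sub_const_mul (hη : IsTestFunction U η) (hθ : IsTestFunction U θ) (r : ℝ) :
    IsTestFunction U fun t => η t - r * θ t where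
  contDiff := hη.contDiff.sub (contDiff_const.mul hθ.contDiff)
  hasCompactSupport := hη.hasCompactSupport.sub hθ.hasCompactSupport.mul_left
  tsupport_subset := (tsupport_sub _ _).trans
    (union_subset hη.tsupport_subset (tsupport_mul_subset_right.trans hθ.tsupport_subset))

theorem exists_integral_eq_one (hab : a < b) :
    ∃ κ : ℝ → ℝ, IsTestFunction (Ioo a b) κ ∧ ∫ t, κ t = 1 := by
  let κ : ContDiffBump ((a + b) / 2) := ⟨(b - a) / 4, (b - a) / 3, by linarith, by linarith⟩
  refine ⟨κ.normed volume, ⟨κ.contDiff_normed, κ.hasCompactSupport_normed, ?_⟩, κ.integral_normed⟩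
  rw [κ.tsupport_normed_eq, Real.closedBall_eq_Icc]
  exact Icc_subset_Ioo (by dsimp only [κ]; linarith) (by dsimp only [κ]; linarith)

theorem exists_Icc_subset (hη : IsTestFunction (Ioo a b) η) :
    ∃ α > a, ∃ β < b, tsupport η ⊆ Icc α β := by
  obtain hempty | hne := (tsupport η).eq_empty_or_nonempty
  · exact ⟨a + 1, by simp, b - 1, by simp, by simp [hempty]⟩
  obtain ⟨α, hα, hmin⟩ := hη.hasCompactSupport.isCompact.exists_isLeast hne
  obtain ⟨β, hβ, hmax⟩ := hη.hasCompactSupport.isCompact.exists_isGreatest hne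
  exact ⟨α, (hη.tsupport_subset hα).1, β, (hη.tsupport_subset hβ).2,
    fun t ht => ⟨hmin ht, hmax ht⟩⟩

theorem exists_deriv_eq (hθ : IsTestFunction (Ioo a b) θ) (h0 : ∫ t, θ t = 0) :
    ∃ ψ : ℝ → ℝ, IsTestFunction (Ioo a b) ψ ∧ deriv ψ = θ := by
  obtain ⟨α, hα, β, hβ, hsub⟩ := hθ.exists_Icc_subset
  let ψ : ℝ → ℝ := fun t => ∫ s in a..t, θ s
  have hderiv (t : ℝ) : HasDerivAt ψ (θ t) t :=
    intervalIntegral.integral_hasDerivAt_right (hθ.continuous.intervalIntegrable _ _)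
      hθ.continuous.stronglyMeasurable.stronglyMeasurableAtFilter hθ.continuous.continuousAt
  have hderiv_eq : deriv ψ = θ := funext fun t => (hderiv t).deriv
  have htsupport : tsupport ψ ⊆ Icc α β :=
    closure_minimal (fun t ht => by_contra fun hmem =>
      ht (intervalIntegral_eq_zero_of_notMem_Icc hα hsub h0 hmem)) isClosed_Icc
  exact ⟨ψ, ⟨contDiff_infty_iff_deriv.2
      ⟨fun t => (hderiv t).differentiableAt, hderiv_eq ▸ hθ.contDiff⟩,
    isCompact_Icc.of_isClosed_subset (isClosed_tsupport _) htsupport,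
    htsupport.trans (Icc_subset_Ioo hα hβ)⟩, hderiv_eq⟩

theorem setIntegral_Ici_deriv (hη : IsTestFunction (Ioo a b) η) {s : ℝ} (hs : s ∈ Ioo a b) :
    ∫ t in Ioo a b, (Ici s).indicator (deriv η) t = -η s := by
  have hset : Ioo a b ∩ Ici s = Ico s b := by
    rw [← Ioi_inter_Iio, inter_right_comm, inter_eq_right.2 (Ici_subset_Ioi.2 hs.1),
      Ici_inter_Iio]
  rw [setIntegral_indicator measurableSet_Ici, hset, integral_Ico_eq_integral_Ioc,
    ← intervalIntegral.integral_of_le hs.2.le, intervalIntegral.integral_deriv_eq_sub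
      (fun t _ => (hη.contDiff.differentiable (by simp)).differentiableAt)
      ((hη.contDiff.continuous_deriv (by simp)).intervalIntegrable _ _),
    hη.eq_zero_of_notMem (by simp), zero_sub]

theorem deriv (hη : IsTestFunction U η) : IsTestFunction U (deriv η) where
  contDiff := (contDiff_infty_iff_deriv.1 hη.contDiff).2
  hasCompactSupport := hη.hasCompactSupport.deriv
  tsupport_subset := tsupport_deriv_subset.trans hη.tsupport_subset

end IsTestFunction

/-- `g` is the weak derivative of `f` on the open set `U ⊆ ℝ`, for vector-valued `f` and `g`. -/
def HasWeakDerivOn (U : Set ℝ) (f g : ℝ → E) : Prop :=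
  ∀ η : ℝ → ℝ, IsTestFunction U η →
    ∫ t in U, deriv η t • f t = -∫ t in U, η t • g t

theorem HasWeakDerivOn.sub {f' g' : ℝ → E} (h : HasWeakDerivOn U f g)
    (h' : HasWeakDerivOn U f' g') (hf : IntegrableOn f U) (hf' : IntegrableOn f' U)
    (hg : IntegrableOn g U) (hg' : IntegrableOn g' U) :
    HasWeakDerivOn U (fun t => f t - f' t) fun t => g t - g' t := fun η hη => by
  simp only [smul_sub]
  rw [integral_sub (hη.deriv.integrableOn_smul hf) (hη.deriv.integrableOn_smul hf'),
    integral_sub (hη.integrableOn_smul hg) (hη.integrableOn_smul hg'), h η hη, h' η hη]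
  abel

theorem setIntegral_Iic_indicator {t : ℝ} (ht : t ∈ Ioo a b) (g : ℝ → E) :
    ∫ s in Ioo a b, (Iic t).indicator g s = ∫ s in a..t, g s := by
  have hset : Ioo a b ∩ Iic t = Ioc a t := by
    rw [← Ioi_inter_Iio, inter_assoc, inter_eq_right.2 (Iic_subset_Iio.2 ht.2), Ioi_inter_Iic]
  rw [setIntegral_indicator measurableSet_Iic, hset, intervalIntegral.integral_of_le ht.1.le]

theorem hasWeakDerivOn_primitive [CompleteSpace E] (hg : IntegrableOn g (Ioo a b)) :
    HasWeakDerivOn (Ioo a b) (fun t => ∫ s in a..t, g s) g := by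
  intro η hη
  have hint : Integrable
      ({z : ℝ × ℝ | z.2 ≤ z.1}.indicator fun z => deriv η z.1 • g z.2)
      ((volume.restrict (Ioo a b)).prod (volume.restrict (Ioo a b))) :=
    (hη.deriv.integrable.integrableOn.smul_prod hg).indicator
      (measurableSet_le measurable_snd measurable_fst)
  calc ∫ t in Ioo a b, deriv η t • ∫ s in a..t, g s
      = ∫ t in Ioo a b, ∫ s in Ioo a b,
          {z : ℝ × ℝ | z.2 ≤ z.1}.indicator (fun z => deriv η z.1 • g z.2) (t, s) := by
        refine setIntegral_congr_fun measurableSet_Ioo fun t ht => ?_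
        rw [← setIntegral_Iic_indicator ht, ← integral_smul]
        simp only [indicator_apply, mem_Iic, mem_ofPred_eq, smul_ite, smul_zero]
    _ = ∫ s in Ioo a b, ∫ t in Ioo a b,
          {z : ℝ × ℝ | z.2 ≤ z.1}.indicator (fun z => deriv η z.1 • g z.2) (t, s) :=
        integral_integral_swap hint
    _ = ∫ s in Ioo a b, -(η s • g s) := by
        refine setIntegral_congr_fun measurableSet_Ioo fun s hs => ?_
        rw [← neg_smul, ← hη.setIntegral_Ici_deriv hs, ← integral_smul_const]
        simp only [indicator_apply, mem_Ici, mem_ofPred_eq, ite_smul, zero_smul]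
    _ = -∫ s in Ioo a b, η s • g s := integral_neg _

theorem HasWeakDerivOn.ae_eq_const [CompleteSpace E] (hab : a < b)
    (hf : IntegrableOn f (Ioo a b)) (h : HasWeakDerivOn (Ioo a b) f fun _ => 0) :
    ∃ c : E, ∀ᵐ t ∂volume.restrict (Ioo a b), f t = c := by
  obtain ⟨κ, hκ, hκ1⟩ := IsTestFunction.exists_integral_eq_one hab
  let c : E := ∫ t in Ioo a b, κ t • f t
  have hconst : IntegrableOn (fun _ => c) (Ioo a b) := integrableOn_const (by simp)
  have horth : ∀ η, IsTestFunction (Ioo a b) η → ∫ t in Ioo a b, η t • (f t - c) = 0 := by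
    intro η hη
    obtain ⟨ψ, hψ, hψ'⟩ := (hη.sub_const_mul hκ (∫ t, η t)).exists_deriv_eq (by
      rw [integral_sub hη.integrable (hκ.integrable.const_mul _), integral_const_mul, hκ1,
        mul_one, sub_self])
    have hmean : ∫ t in Ioo a b, η t • f t = (∫ t, η t) • c := by
      have hzero := h ψ hψ
      simp only [hψ', sub_smul, mul_smul, smul_zero, integral_zero, neg_zero] at hzero
      rwa [integral_sub (hη.integrableOn_smul hf) ((hκ.integrableOn_smul hf).fun_smul _),
        integral_smul, sub_eq_zero] at hzero
    simp only [smul_sub]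
    rw [integral_sub (hη.integrableOn_smul hf) (hη.integrableOn_smul hconst), hmean,
      hη.setIntegral_smul, integral_smul_const, sub_self]
  refine ⟨c, (ae_restrict_iff' measurableSet_Ioo).2 ?_⟩
  filter_upwards [isOpen_Ioo.ae_eq_zero_of_integral_contDiff_smul_eq_zero
    (hf.sub hconst).locallyIntegrableOn fun η hη hc hs =>
      (IsTestFunction.setIntegral_smul ⟨hη, hc, hs⟩ _).symm.trans (horth η ⟨hη, hc, hs⟩)]
    with t ht hmem
  exact sub_eq_zero.1 (ht hmem)

theorem HasWeakDerivOn.ae_eq_primitive [CompleteSpace E] (hab : a < b)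
    (hf : IntegrableOn f (Ioo a b)) (hg : IntegrableOn g (Ioo a b))
    (h : HasWeakDerivOn (Ioo a b) f g) :
    ∃ c : E, ∀ᵐ t ∂volume.restrict (Ioo a b), f t = c + ∫ s in a..t, g s := by
  have hprimitive : IntegrableOn (fun t => ∫ s in a..t, g s) (Ioo a b) := by
    have hcont := intervalIntegral.continuousOn_primitive_interval (a := a) (b := b) (f := g)
      (μ := volume) (by rwa [uIcc_of_le hab.le, integrableOn_Icc_iff_integrableOn_Ioo])
    rw [uIcc_of_le hab.le] at hcont
    exact hcont.integrableOn_Icc.mono_set Ioo_subset_Icc_self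
  have hdiff := h.sub (hasWeakDerivOn_primitive hg) hf hprimitive hg hg
  simp only [sub_self] at hdiff
  obtain ⟨c, hc⟩ := hdiff.ae_eq_const hab (hf.sub hprimitive)
  exact ⟨c, hc.mono fun t ht => sub_eq_iff_eq_add.1 ht⟩

end WeakDerivative

section Translation

variable {E : Type*} [NormedAddCommGroup E] {p : ℝ≥0∞}

/-- The translate `x ↦ f (r + x)` of `f ∈ Lᵖ(ℝ; E)`. -/
def translate (r : ℝ) (f : Lp E p (volume : Measure ℝ)) : Lp E p (volume : Measure ℝ) :=
  DomAddAct.mk r +ᵥ f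

theorem coeFn_translate (r : ℝ) (f : Lp E p (volume : Measure ℝ)) :
    translate r f =ᵐ[volume] fun x => f (r + x) :=
  DomAddAct.vadd_Lp_ae_eq _ f

theorem translate_zero (f : Lp E p (volume : Measure ℝ)) : translate 0 f = f :=
  zero_vadd ℝᵈᵃᵃ f

theorem continuous_translate [Fact (1 ≤ p)] (hp : p ≠ (∞ : ℝ≥0∞))
    (f : Lp E p (volume : Measure ℝ)) : Continuous fun r => translate r f :=
  have : Fact (p ≠ (∞ : ℝ≥0∞)) := ⟨hp⟩
  DomAddAct.continuous_mk.vadd continuous_const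

theorem intervalIntegrable_Lp (hp : 1 ≤ p) (f : Lp E p (volume : Measure ℝ)) (a b : ℝ) :
    IntervalIntegrable f volume a b :=
  (((Lp.memLp f).locallyIntegrable hp).integrableOn_isCompact isCompact_uIcc).intervalIntegrable

end Translation

section EnergyIdentity

variable {X : Type*} [NormedAddCommGroup X] [NormedSpace ℝ X]

/-- The pairing `(g, y) ↦ ∫ₛ ⟨g(t), y(t)⟩ dt` of `L²(ℝ; X*)` with `L²(ℝ; X)`. -/
def pairingOn (s : Set ℝ) :
    Lp (StrongDual ℝ X) 2 (volume : Measure ℝ) →L[ℝ] Lp X 2 (volume : Measure ℝ) →L[ℝ] ℝ :=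
  ((ContinuousLinearMap.id ℝ (StrongDual ℝ X)).lpPairing (volume.restrict s) 2 2).bilinearComp
    (LpToLpRestrictCLM ℝ _ ℝ volume 2 s) (LpToLpRestrictCLM ℝ _ ℝ volume 2 s)

theorem pairingOn_apply (s : Set ℝ) (g : Lp (StrongDual ℝ X) 2 (volume : Measure ℝ))
    (y : Lp X 2 (volume : Measure ℝ)) : pairingOn s g y = ∫ t in s, g t (y t) := by
  rw [pairingOn, ContinuousLinearMap.bilinearComp_apply, ContinuousLinearMap.lpPairing_eq_integral]
  refine integral_congr_ae ?_
  filter_upwards [LpToLpRestrictCLM_coeFn ℝ s g, LpToLpRestrictCLM_coeFn ℝ s y] with t hg hy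
  rw [hg, hy, ContinuousLinearMap.id_apply]

theorem integrable_translate_pairing (s : Set ℝ) (h : ℝ)
    (g : Lp (StrongDual ℝ X) 2 (volume : Measure ℝ)) (z : Lp X 2 (volume : Measure ℝ)) :
    Integrable (fun p : ℝ × ℝ => g (p.1 + p.2) (z p.2))
      ((volume.restrict (Ioc 0 h)).prod (volume.restrict s)) := by
  have hg : MemLp (fun p : ℝ × ℝ => g (p.1 + p.2)) 2
      ((volume.restrict (Ioc 0 h)).prod volume) :=
    ((Lp.memLp g).comp_snd (volume.restrict (Ioc 0 h))).comp_measurePreserving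
      (measurePreserving_prod_add _ _)
  have hz : MemLp (fun p : ℝ × ℝ => z p.2) 2 ((volume.restrict (Ioc 0 h)).prod volume) :=
    (Lp.memLp z).comp_snd _
  have hgz := (ContinuousLinearMap.id ℝ (StrongDual ℝ X)).memLp_of_bilin 1 hg hz
  exact (memLp_one_iff_integrable.1 hgz).mono_measure
    (Measure.prod_mono le_rfl Measure.restrict_le_self)

theorem intervalIntegral_pairingOn_translate {h : ℝ} (hh : 0 ≤ h) (s : Set ℝ)
    (g : Lp (StrongDual ℝ X) 2 (volume : Measure ℝ)) (z : Lp X 2 (volume : Measure ℝ)) :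
    ∫ r in 0..h, pairingOn s (translate r g) z
      = ∫ t in s, (∫ r in t..t + h, g r) (z t) := by
  calc ∫ r in 0..h, pairingOn s (translate r g) z
      = ∫ r in 0..h, ∫ t in s, g (r + t) (z t) :=
        intervalIntegral.integral_congr fun r _ => by
          rw [pairingOn_apply]
          refine integral_congr_ae ?_
          filter_upwards [ae_restrict_of_ae (coeFn_translate r g)] with t ht
          rw [ht]
    _ = ∫ t in s, ∫ r in 0..h, g (r + t) (z t) := by
        simp only [intervalIntegral.integral_of_le hh]
        exact integral_integral_swap (integrable_translate_pairing s h g z)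
    _ = ∫ t in s, (∫ r in t..t + h, g r) (z t) := by
        congr with t
        have hint : IntervalIntegrable (fun r => g (r + t)) volume 0 h := by
          simpa using (intervalIntegrable_Lp one_le_two g t (h + t)).comp_add_right t
        rw [← ContinuousLinearMap.intervalIntegral_apply hint,
          intervalIntegral.integral_comp_add_right, zero_add, add_comm h]

theorem tendsto_inv_mul_integral_pairingOn (s : Set ℝ)
    (g : Lp (StrongDual ℝ X) 2 (volume : Measure ℝ)) (y : Lp X 2 (volume : Measure ℝ)) :
    Tendsto (fun h => h⁻¹ * ∫ r in 0..h, pairingOn s (translate r g) (translate h y + y))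
      (𝓝[>] 0) (𝓝 (2 * ∫ t in s, g t (y t))) := by
  let F : ℝ → ℝ → ℝ := fun h r => pairingOn s (translate (h * r) g) (translate h y + y)
  have hF : Continuous (Function.uncurry F) :=
    (((pairingOn s).continuous.comp ((continuous_translate (by simp) g).comp
      (continuous_fst.mul continuous_snd))).clm_apply
        (((continuous_translate (by simp) y).comp continuous_fst).add continuous_const))
  have hlim := (intervalIntegral.continuous_parametric_intervalIntegral_of_continuous'
    (μ := volume) hF 0 1).tendsto 0
  have hvalue : ∫ r in (0 : ℝ)..1, F 0 r = 2 * ∫ t in s, g t (y t) := by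
    simp only [F, zero_mul, translate_zero, map_add, pairingOn_apply,
      intervalIntegral.integral_const]
    ring
  rw [hvalue] at hlim
  refine (hlim.mono_left nhdsWithin_le_nhds).congr' ?_
  filter_upwards [self_mem_nhdsWithin] with h hh
  have hscale := intervalIntegral.mul_integral_comp_mul_left (a := 0) (b := 1) h
    (f := fun r => pairingOn s (translate r g) (translate h y + y))
  simp only [mul_zero, mul_one] at hscale
  rw [← hscale, inv_mul_cancel_left₀ (ne_of_gt hh)]

theorem tendsto_inv_mul_integral_shift_sub {e : ℝ → ℝ} (he : LocallyIntegrable e volume) {α β : ℝ}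
    (hα : HasDerivAt (fun t => ∫ s in 0..t, e s) (e α) α)
    (hβ : HasDerivAt (fun t => ∫ s in 0..t, e s) (e β) β) :
    Tendsto (fun h => h⁻¹ * ∫ t in α..β, (e (t + h) - e t)) (𝓝[>] 0) (𝓝 (e β - e α)) := by
  have hint (u v : ℝ) : IntervalIntegrable e volume u v :=
    (he.integrableOn_isCompact isCompact_uIcc).intervalIntegrable
  refine (hβ.tendsto_slope_zero_right.sub hα.tendsto_slope_zero_right).congr fun h => ?_
  have hshift : IntervalIntegrable (fun t => e (t + h)) volume α β := by
    simpa using (hint (α + h) (β + h)).comp_add_right h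
  rw [intervalIntegral.integral_sub hshift (hint α β), intervalIntegral.integral_comp_add_right,
    ← intervalIntegral.integral_interval_sub_left (hint 0 (β + h)) (hint 0 (α + h)),
    ← intervalIntegral.integral_interval_sub_left (hint 0 β) (hint 0 α)]
  simp only [smul_eq_mul]
  ring

variable {𝓗 : Type*} [NormedAddCommGroup 𝓗] [InnerProductSpace ℝ 𝓗] (ι : X →L[ℝ] 𝓗)

/-- The map `X → 𝓗 = 𝓗* → X*` of the Gelfand triple given by `ι : X → 𝓗`. -/
def pivot : X →L[ℝ] StrongDual ℝ X := (innerSL ℝ).bilinearComp ι ι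

theorem pivot_apply (x z : X) : pivot ι x z = inner ℝ (ι x) (ι z) := rfl

theorem pivot_sub_apply_add (x z : X) :
    (pivot ι x - pivot ι z) (x + z) = ‖ι x‖ ^ 2 - ‖ι z‖ ^ 2 := by
  simp only [sub_apply, pivot_apply, map_add,
    real_inner_self_eq_norm_sq, real_inner_comm (ι z)]
  ring

variable {ι} {a b : ℝ} {c : StrongDual ℝ X} {y : Lp X 2 (volume : Measure ℝ)}
  {g : Lp (StrongDual ℝ X) 2 (volume : Measure ℝ)}

theorem intervalIntegral_normSq_shift_sub
    (hy : ∀ᵐ t, t ∈ Ioo a b → pivot ι (y t) = c + ∫ s in a..t, g s) {α β h : ℝ}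
    (hα : a < α) (hαβ : α ≤ β) (hh : 0 ≤ h) (hβ : β + h < b) :
    ∫ t in α..β, (‖ι (y (t + h))‖ ^ 2 - ‖ι (y t)‖ ^ 2)
      = ∫ r in 0..h, pairingOn (Ioc α β) (translate r g) (translate h y + y) := by
  rw [intervalIntegral_pairingOn_translate hh, intervalIntegral.integral_of_le hαβ]
  refine setIntegral_congr_ae measurableSet_Ioc ?_
  filter_upwards [hy, (measurePreserving_add_right volume h).quasiMeasurePreserving.ae hy,
    coeFn_translate h y, Lp.coeFn_add (translate h y) y] with t ht hth htranslate hadd hmem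
  have hincrement : ∫ r in t..t + h, g r = pivot ι (y (t + h)) - pivot ι (y t) := by
    rw [hth ⟨by linarith [hmem.1], by linarith [hmem.2]⟩,
      ht ⟨by linarith [hmem.1], by linarith [hmem.2]⟩, add_sub_add_left_eq_sub,
      intervalIntegral.integral_interval_sub_left (intervalIntegrable_Lp one_le_two g _ _)
        (intervalIntegrable_Lp one_le_two g _ _)]
  rw [hincrement, hadd, Pi.add_apply, htranslate, add_comm h t, pivot_sub_apply_add]

theorem normSq_sub_normSq_of_hasDerivAt
    (hy : ∀ᵐ t, t ∈ Ioo a b → pivot ι (y t) = c + ∫ s in a..t, g s) {α β : ℝ}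
    (hα : HasDerivAt (fun t => ∫ s in 0..t, ‖ι (y s)‖ ^ 2) (‖ι (y α)‖ ^ 2) α)
    (hβ : HasDerivAt (fun t => ∫ s in 0..t, ‖ι (y s)‖ ^ 2) (‖ι (y β)‖ ^ 2) β)
    (haα : a < α) (hαβ : α ≤ β) (hβb : β < b) :
    ‖ι (y β)‖ ^ 2 - ‖ι (y α)‖ ^ 2 = 2 * ∫ t in α..β, g t (y t) := by
  have he : Integrable fun t => ‖ι (y t)‖ ^ 2 :=
    (ι.comp_memLp' (Lp.memLp y)).integrable_norm_pow two_ne_zero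
  have hlim := tendsto_inv_mul_integral_shift_sub he.locallyIntegrable hα hβ
  rw [intervalIntegral.integral_of_le hαβ]
  refine tendsto_nhds_unique hlim
    ((tendsto_inv_mul_integral_pairingOn (Ioc α β) g y).congr' ?_)
  filter_upwards [Ioo_mem_nhdsGT (sub_pos.2 hβb)] with h hh
  rw [intervalIntegral_normSq_shift_sub hy haα hαβ hh.1.le (by linarith [hh.2])]

theorem integrable_pairing {μ : Measure ℝ} {y : ℝ → X} {g : ℝ → StrongDual ℝ X}
    (hg : MemLp g 2 μ) (hy : MemLp y 2 μ) : Integrable (fun t => g t (y t)) μ :=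
  memLp_one_iff_integrable.1 ((ContinuousLinearMap.id ℝ (StrongDual ℝ X)).memLp_of_bilin 1 hg hy)

theorem intervalIntegrable_of_integrableOn_Ioo {F : Type*} [NormedAddCommGroup F] {f : ℝ → F}
    (hf : IntegrableOn f (Ioo a b)) {s t : ℝ} (hs : s ∈ Icc a b) (ht : t ∈ Icc a b) :
    IntervalIntegrable f volume s t := by
  rw [← integrableOn_Icc_iff_integrableOn_Ioo] at hf
  exact (hf.mono_set (uIcc_subset_Icc hs ht)).intervalIntegrable

theorem ae_normSq_eq_add_integral
    (hy : ∀ᵐ t, t ∈ Ioo a b → pivot ι (y t) = c + ∫ s in a..t, g s) :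
    ∃ c₀ : ℝ, ∀ᵐ t, t ∈ Ioo a b → ‖ι (y t)‖ ^ 2 = c₀ + 2 * ∫ s in a..t, g s (y s) := by
  obtain hba | hab := le_or_gt b a
  · simp [Ioo_eq_empty_of_le hba]
  have he : Integrable fun t => ‖ι (y t)‖ ^ 2 :=
    (ι.comp_memLp' (Lp.memLp y)).integrable_norm_pow two_ne_zero
  have hLebesgue := (LocallyIntegrable.ae_hasDerivAt_integral he.locallyIntegrable).mono
    fun t ht => ht 0
  have hint (s t : ℝ) : IntervalIntegrable (fun r => g r (y r)) volume s t :=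
    (integrable_pairing (Lp.memLp g) (Lp.memLp y)).intervalIntegrable
  obtain ⟨s, hsab, hs⟩ := Measure.exists_mem_of_measure_ne_zero_of_ae (s := Ioo a b)
    (by simpa using hab)
    (ae_restrict_of_ae hLebesgue)
  refine ⟨‖ι (y s)‖ ^ 2 - 2 * ∫ r in a..s, g r (y r), ?_⟩
  filter_upwards [hLebesgue] with t ht htab
  have hst : ‖ι (y t)‖ ^ 2 - ‖ι (y s)‖ ^ 2 = 2 * ∫ r in s..t, g r (y r) := by
    obtain hst | hts := le_total s t
    · exact normSq_sub_normSq_of_hasDerivAt hy hs ht hsab.1 hst htab.2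
    · have hneg := normSq_sub_normSq_of_hasDerivAt hy ht hs htab.1 hts hsab.2
      rw [intervalIntegral.integral_symm] at hneg
      linarith
  linarith [intervalIntegral.integral_add_adjacent_intervals (hint a s) (hint s t)]

end EnergyIdentity

section ContinuousRepresentative

theorem exists_continuousOn_closure_eqOn {α β : Type*} [PseudoMetricSpace α] [MetricSpace β]
    [CompleteSpace β] {f : α → β} {A : Set α} (hf : UniformContinuousOn f A) :
    ∃ F : α → β, ContinuousOn F (closure A) ∧ EqOn F f A := by
  refine ⟨extendFrom A f, continuousOn_extendFrom subset_rfl fun x hx => ?_,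
    extendFrom_extends hf.continuousOn⟩
  have : (𝓝[A] x).NeBot := mem_closure_iff_nhdsWithin_neBot.1 hx
  exact cauchy_map_iff_exists_tendsto.1
    ((cauchy_nhds.mono nhdsWithin_le_nhds).map_of_le hf inf_le_right)

variable {X 𝓗 : Type*} [NormedAddCommGroup X] [NormedSpace ℝ X] [NormedAddCommGroup 𝓗]
  [InnerProductSpace ℝ 𝓗] {ι : X →L[ℝ] 𝓗} {a b : ℝ} {c : StrongDual ℝ X} {c₀ : ℝ} {y : ℝ → X}
  {g : ℝ → StrongDual ℝ X} {A : Set ℝ}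

theorem integrableOn_normSq_add_normSq (hy : MemLp y 2 (volume.restrict (Ioo a b)))
    (hg : MemLp g 2 (volume.restrict (Ioo a b))) :
    IntegrableOn (fun t => ‖y t‖ ^ 2 + ‖g t‖ ^ 2) (Ioo a b) :=
  (hy.integrable_norm_pow two_ne_zero).add (hg.integrable_norm_pow two_ne_zero)

theorem exists_Lp_ae_eq_on {α F : Type*} [MeasurableSpace α] [NormedAddCommGroup F] {p : ℝ≥0∞}
    {μ : Measure α} {s : Set α} {f : α → F} (hs : MeasurableSet s) (hf : MemLp f p (μ.restrict s)) :
    ∃ F : Lp F p μ, ∀ᵐ x ∂μ, x ∈ s → F x = f x :=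
  have hf' : MemLp (s.indicator f) p μ := (memLp_indicator_iff_restrict hs).2 hf
  ⟨hf'.toLp, hf'.coeFn_toLp.mono fun _ hx hmem => hx.trans (indicator_of_mem hmem f)⟩

theorem ae_restrict_normSq_eq_add_integral (hy : MemLp y 2 (volume.restrict (Ioo a b)))
    (hg : MemLp g 2 (volume.restrict (Ioo a b)))
    (hyg : ∀ᵐ t ∂volume.restrict (Ioo a b), pivot ι (y t) = c + ∫ s in a..t, g s) :
    ∃ c₀ : ℝ, ∀ᵐ t ∂volume.restrict (Ioo a b),
      ‖ι (y t)‖ ^ 2 = c₀ + 2 * ∫ s in a..t, g s (y s) := by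
  obtain ⟨Y, hY⟩ := exists_Lp_ae_eq_on measurableSet_Ioo hy
  obtain ⟨G, hG⟩ := exists_Lp_ae_eq_on measurableSet_Ioo hg
  have hsub {s t : ℝ} (ht : t ∈ Ioo a b) (hs : s ∈ uIoc a t) : s ∈ Ioo a b := by
    rw [uIoc_of_le ht.1.le] at hs
    exact ⟨hs.1, hs.2.trans_lt ht.2⟩
  simp only [ae_restrict_iff' measurableSet_Ioo] at hyg ⊢
  have hYG : ∀ᵐ t, t ∈ Ioo a b → pivot ι (Y t) = c + ∫ s in a..t, G s := by
    filter_upwards [hyg, hY] with t ht hYt hmem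
    rw [hYt hmem, ht hmem]
    congr 1
    exact intervalIntegral.integral_congr_ae (hG.mono fun s hs hst => (hs (hsub hmem hst)).symm)
  obtain ⟨c₀, hc₀⟩ := ae_normSq_eq_add_integral hYG
  refine ⟨c₀, ?_⟩
  filter_upwards [hc₀, hY] with t ht hYt hmem
  rw [← hYt hmem, ht hmem]
  congr 2
  refine intervalIntegral.integral_congr_ae ?_
  filter_upwards [hY, hG] with s hYs hGs hst
  rw [hYs (hsub hmem hst), hGs (hsub hmem hst)]

theorem normSq_sub_eq_integral (hy : MemLp y 2 (volume.restrict (Ioo a b)))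
    (hg : MemLp g 2 (volume.restrict (Ioo a b))) (hsub : A ⊆ Ioo a b)
    (hyg : ∀ t ∈ A, pivot ι (y t) = c + ∫ s in a..t, g s)
    (henergy : ∀ t ∈ A, ‖ι (y t)‖ ^ 2 = c₀ + 2 * ∫ s in a..t, g s (y s)) {s t : ℝ} (hs : s ∈ A)
    (ht : t ∈ A) : ‖ι (y t) - ι (y s)‖ ^ 2 = 2 * ∫ r in s..t, g r (y r - y s) := by
  have hleft : a ∈ Icc a b := left_mem_Icc.2 ((hsub hs).1.trans (hsub hs).2).le
  have hpair {u v : ℝ} (hu : u ∈ Icc a b) (hv : v ∈ Icc a b) :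
      IntervalIntegrable (fun r => g r (y r)) volume u v :=
    intervalIntegrable_of_integrableOn_Ioo (integrable_pairing hg hy) hu hv
  have hdual {u v : ℝ} (hu : u ∈ Icc a b) (hv : v ∈ Icc a b) : IntervalIntegrable g volume u v :=
    intervalIntegrable_of_integrableOn_Ioo (hg.integrable one_le_two) hu hv
  have hs' := Ioo_subset_Icc_self (hsub hs)
  have ht' := Ioo_subset_Icc_self (hsub ht)
  have hincrement : ∫ r in s..t, g r (y s) = pivot ι (y t) (y s) - pivot ι (y s) (y s) := by
    rw [← ContinuousLinearMap.intervalIntegral_apply (hdual hs' ht'), ← sub_apply, hyg t ht,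
      hyg s hs, add_sub_add_left_eq_sub,
      intervalIntegral.integral_interval_sub_left (hdual hleft ht') (hdual hleft hs')]
  have hconst : IntervalIntegrable (fun r => g r (y s)) volume s t :=
    ⟨(hdual hs' ht').1.apply_continuousLinearMap _, (hdual hs' ht').2.apply_continuousLinearMap _⟩
  simp only [map_sub]
  rw [intervalIntegral.integral_sub (hpair hs' ht') hconst, hincrement,
    ← intervalIntegral.integral_interval_sub_left (hpair hleft ht') (hpair hleft hs'),
    pivot_apply, pivot_apply, real_inner_self_eq_norm_sq, norm_sub_sq_real]
  linarith [henergy t ht, henergy s hs]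

theorem normSq_sub_le_integral {F : Type*} [SeminormedAddCommGroup F] {f : ℝ → F}
    (hy : MemLp y 2 (volume.restrict (Ioo a b))) (hg : MemLp g 2 (volume.restrict (Ioo a b)))
    {s t u v : ℝ} (hu : u ∈ Icc a b) (hv : v ∈ Icc a b) (hs : s ∈ Icc u v) (ht : t ∈ Icc u v)
    (hf : ‖f t - f s‖ ^ 2 = 2 * ∫ r in s..t, g r (y r - y s))
    (hmean : (v - u) * ‖y s‖ ^ 2 ≤ ∫ r in u..v, ‖y r‖ ^ 2) :
    ‖f t - f s‖ ^ 2 ≤ 2 * ∫ r in u..v, (‖y r‖ ^ 2 + ‖g r‖ ^ 2) := by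
  have huv : u ≤ v := hs.1.trans hs.2
  have hysq : IntervalIntegrable (fun r => ‖y r‖ ^ 2) volume u v :=
    intervalIntegrable_of_integrableOn_Ioo (hy.integrable_norm_pow two_ne_zero) hu hv
  have hgsq : IntervalIntegrable (fun r => ‖g r‖ ^ 2) volume u v :=
    intervalIntegrable_of_integrableOn_Ioo (hg.integrable_norm_pow two_ne_zero) hu hv
  have hbound (r : ℝ) : ‖g r (y r - y s)‖ ≤ ‖g r‖ ^ 2 + (‖y r‖ ^ 2 + ‖y s‖ ^ 2) / 2 := by
    nlinarith [(g r).le_opNorm (y r - y s), norm_sub_le (y r) (y s), norm_nonneg (g r),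
      sq_nonneg (‖g r‖ - ‖y r‖), sq_nonneg (‖g r‖ - ‖y s‖)]
  have hboundint : IntervalIntegrable (fun r => ‖g r‖ ^ 2 + (‖y r‖ ^ 2 + ‖y s‖ ^ 2) / 2)
      volume u v := hgsq.add ((hysq.add intervalIntegrable_const).div_const 2)
  have hle : ∫ r in s..t, g r (y r - y s)
      ≤ ∫ r in u..v, (‖g r‖ ^ 2 + (‖y r‖ ^ 2 + ‖y s‖ ^ 2) / 2) := by
    rw [intervalIntegral.integral_of_le huv]
    calc ∫ r in s..t, g r (y r - y s) ≤ ‖∫ r in s..t, g r (y r - y s)‖ := Real.le_norm_self _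
      _ ≤ ∫ r in uIoc s t, ‖g r‖ ^ 2 + (‖y r‖ ^ 2 + ‖y s‖ ^ 2) / 2 := by
        rw [intervalIntegral.norm_intervalIntegral_eq]
        exact norm_integral_le_of_norm_le
          (hboundint.1.mono_set (Ioc_subset_Ioc (le_min hs.1 ht.1) (max_le hs.2 ht.2)))
          (Eventually.of_forall hbound)
      _ ≤ _ := setIntegral_mono_set hboundint.1 (Eventually.of_forall fun r => by positivity)
        (Ioc_subset_Ioc (le_min hs.1 ht.1) (max_le hs.2 ht.2)).eventuallyLE
  rw [intervalIntegral.integral_add hgsq ((hysq.add intervalIntegrable_const).div_const 2),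
    intervalIntegral.integral_div, intervalIntegral.integral_add hysq intervalIntegrable_const,
    intervalIntegral.integral_const, smul_eq_mul] at hle
  rw [intervalIntegral.integral_add hysq hgsq]
  linarith

theorem exists_mem_mul_le_integral {e : ℝ → ℝ} {u v : ℝ} (huv : u < v)
    (he : IntegrableOn e (Ioo u v)) (hA : ∀ᵐ t ∂volume.restrict (Ioo u v), t ∈ A) :
    ∃ s ∈ A, s ∈ Ioo u v ∧ (v - u) * e s ≤ ∫ r in u..v, e r := by
  have hA' : ∀ᵐ t ∂volume.restrict (Ioo u v), t ∈ A ∧ t ∈ Ioo u v :=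
    hA.and (ae_restrict_mem measurableSet_Ioo)
  obtain ⟨s, hs, hle⟩ := exists_notMem_null_le_average (μ := volume.restrict (Ioo u v))
    (by simpa using huv) he hA'
  obtain ⟨hsA, hsuv⟩ := not_not.1 hs
  refine ⟨s, hsA, hsuv, ?_⟩
  rw [setAverage_eq, measureReal_def, Real.volume_Ioo, ENNReal.toReal_ofReal (by linarith),
    ← integral_Ioc_eq_integral_Ioo, ← intervalIntegral.integral_of_le huv.le, smul_eq_mul] at hle
  rwa [← le_inv_mul_iff₀ (sub_pos.2 huv)]

/- A direct Cauchy–Schwarz estimate of `f t - f s` fails, as `y s` is not bounded in `X`; so one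
passes through an intermediate time at which `‖y‖²` is at most its mean. -/
theorem normSq_sub_le_eight_mul_integral {F : Type*} [SeminormedAddCommGroup F] {f : ℝ → F}
    (hy : MemLp y 2 (volume.restrict (Ioo a b))) (hg : MemLp g 2 (volume.restrict (Ioo a b)))
    (hsub : A ⊆ Ioo a b)
    (hA : ∀ᵐ t ∂volume.restrict (Ioo a b), t ∈ A)
    (hf : ∀ s ∈ A, ∀ t ∈ A, ‖f t - f s‖ ^ 2 = 2 * ∫ r in s..t, g r (y r - y s))
    {u v : ℝ} (hu : u ∈ A) (hv : v ∈ A) (huv : u ≤ v) :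
    ‖f v - f u‖ ^ 2 ≤ 8 * ∫ r in u..v, (‖y r‖ ^ 2 + ‖g r‖ ^ 2) := by
  obtain rfl | huv := huv.eq_or_lt
  · simp
  have hwindow : Ioo u v ⊆ Ioo a b := Ioo_subset_Ioo (hsub hu).1.le (hsub hv).2.le
  obtain ⟨s, hs, hsuv, hmean⟩ := exists_mem_mul_le_integral huv
    ((hy.integrable_norm_pow two_ne_zero).mono_measure (Measure.restrict_mono hwindow le_rfl))
    (ae_restrict_of_ae_restrict_of_subset hwindow hA)
  have hle {t : ℝ} (ht : t ∈ A) (htuv : t ∈ Icc u v) :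
      ‖f t - f s‖ ^ 2 ≤ 2 * ∫ r in u..v, (‖y r‖ ^ 2 + ‖g r‖ ^ 2) :=
    normSq_sub_le_integral hy hg (Ioo_subset_Icc_self (hsub hu)) (Ioo_subset_Icc_self (hsub hv))
      (Ioo_subset_Icc_self hsuv) htuv (hf s hs t ht) hmean
  have htriangle := norm_sub_le_norm_sub_add_norm_sub (f v) (f s) (f u)
  rw [norm_sub_rev (f s)] at htriangle
  nlinarith [hle hu (left_mem_Icc.2 huv.le), hle hv (right_mem_Icc.2 huv.le),
    norm_nonneg (f v - f u), sq_nonneg (‖f v - f s‖ - ‖f u - f s‖)]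

theorem continuousOn_integral_Icc {F : Type*} [NormedAddCommGroup F] [NormedSpace ℝ F]
    {h : ℝ → F} (hab : a ≤ b) (hh : IntegrableOn h (Ioo a b)) :
    ContinuousOn (fun t => ∫ s in a..t, h s) (Icc a b) := by
  rw [← integrableOn_Icc_iff_integrableOn_Ioo, ← uIcc_of_le hab] at hh
  simpa only [uIcc_of_le hab] using intervalIntegral.continuousOn_primitive_interval hh

theorem uniformContinuousOn_of_dist_sq_le {F : Type*} [PseudoMetricSpace F] {f : ℝ → F} {e : ℝ → ℝ}
    (hab : a ≤ b) (he : IntegrableOn e (Ioo a b)) (hsub : A ⊆ Icc a b)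
    (hf : ∀ s ∈ A, ∀ t ∈ A, s ≤ t → dist (f t) (f s) ^ 2 ≤ ∫ r in s..t, e r) :
    UniformContinuousOn f A := by
  have hprimitive : UniformContinuousOn (fun t => ∫ r in a..t, e r) A :=
    (isCompact_Icc.uniformContinuousOn_of_continuous
      (continuousOn_integral_Icc hab he)).mono hsub
  have hint {t : ℝ} (ht : t ∈ A) : IntervalIntegrable e volume a t :=
    intervalIntegrable_of_integrableOn_Ioo he (left_mem_Icc.2 hab) (hsub ht)
  have hdist : ∀ s ∈ A, ∀ t ∈ A,
      dist (f s) (f t) ^ 2 ≤ dist (∫ r in a..s, e r) (∫ r in a..t, e r) := by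
    intro s hs t ht
    wlog hst : s ≤ t generalizing s t
    · simpa only [dist_comm] using this t ht s hs (le_of_not_ge hst)
    rw [dist_comm, dist_comm (∫ r in a..s, e r), Real.dist_eq,
      intervalIntegral.integral_interval_sub_left (hint ht) (hint hs)]
    exact (hf s hs t ht hst).trans (le_abs_self _)
  rw [Metric.uniformContinuousOn_iff] at hprimitive ⊢
  intro ε hε
  obtain ⟨δ, hδ, hclose⟩ := hprimitive (ε ^ 2) (by positivity)
  exact ⟨δ, hδ, fun s hs t ht hst =>
    lt_of_pow_lt_pow_left₀ 2 hε.le ((hdist s hs t ht).trans_lt (hclose s hs t ht hst))⟩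

theorem Icc_subset_closure_of_ae (hab : a < b) (hA : ∀ᵐ t ∂volume.restrict (Ioo a b), t ∈ A) :
    Icc a b ⊆ closure A := by
  rw [← closure_Ioo hab.ne]
  refine closure_minimal (fun t ht => ?_) isClosed_closure
  have hdense := Measure.dense_of_ae ((ae_restrict_iff' measurableSet_Ioo).1 hA)
  refine closure_mono ?_ (isOpen_Ioo.inter_closure ⟨ht, hdense t⟩)
  exact fun s hs => hs.2 hs.1

theorem exists_continuousOn_Icc_ae_eq [CompleteSpace 𝓗] (hab : a < b)
    (hy : MemLp y 2 (volume.restrict (Ioo a b))) (hg : MemLp g 2 (volume.restrict (Ioo a b)))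
    (hyg : ∀ᵐ t ∂volume.restrict (Ioo a b), pivot ι (y t) = c + ∫ s in a..t, g s) :
    ∃ Y : ℝ → 𝓗, ContinuousOn Y (Icc a b) ∧ ∀ᵐ t ∂volume.restrict (Ioo a b), Y t = ι (y t) := by
  obtain ⟨c₀, henergy⟩ := ae_restrict_normSq_eq_add_integral hy hg hyg
  let A : Set ℝ := {t | t ∈ Ioo a b ∧ pivot ι (y t) = c + (∫ s in a..t, g s) ∧
    ‖ι (y t)‖ ^ 2 = c₀ + 2 * ∫ s in a..t, g s (y s)}
  have hA : ∀ᵐ t ∂volume.restrict (Ioo a b), t ∈ A :=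
    (ae_restrict_mem measurableSet_Ioo).and (hyg.and henergy)
  have hsub : A ⊆ Ioo a b := fun t ht => ht.1
  have hidentity : ∀ s ∈ A, ∀ t ∈ A,
      ‖ι (y t) - ι (y s)‖ ^ 2 = 2 * ∫ r in s..t, g r (y r - y s) := fun s hs t ht =>
    normSq_sub_eq_integral hy hg hsub (fun r hr => hr.2.1) (fun r hr => hr.2.2) hs ht
  have huniform : UniformContinuousOn (fun t => ι (y t)) A :=
    uniformContinuousOn_of_dist_sq_le hab.le ((integrableOn_normSq_add_normSq hy hg).const_mul 8)
      (hsub.trans Ioo_subset_Icc_self) fun s hs t ht hst => by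
        rw [intervalIntegral.integral_const_mul, dist_eq_norm]
        exact normSq_sub_le_eight_mul_integral hy hg hsub hA hidentity hs ht hst
  obtain ⟨Y, hY, hYA⟩ := exists_continuousOn_closure_eqOn huniform
  exact ⟨Y, hY.mono (Icc_subset_closure_of_ae hab hA), hA.mono hYA⟩

theorem normSq_sub_normSq_eq_integral (hab : a < b) (hy : MemLp y 2 (volume.restrict (Ioo a b)))
    (hg : MemLp g 2 (volume.restrict (Ioo a b)))
    (hyg : ∀ᵐ t ∂volume.restrict (Ioo a b), pivot ι (y t) = c + ∫ s in a..t, g s) {Y : ℝ → 𝓗}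
    (hY : ContinuousOn Y (Icc a b)) (hYy : ∀ᵐ t ∂volume.restrict (Ioo a b), Y t = ι (y t))
    {s t : ℝ} (hs : s ∈ Icc a b) (ht : t ∈ Icc a b) :
    ‖Y t‖ ^ 2 - ‖Y s‖ ^ 2 = 2 * ∫ r in s..t, g r (y r) := by
  obtain ⟨c₀, henergy⟩ := ae_restrict_normSq_eq_add_integral hy hg hyg
  have hpair := integrable_pairing hg hy
  have heq : EqOn (fun t => ‖Y t‖ ^ 2) (fun t => c₀ + 2 * ∫ s in a..t, g s (y s)) (Icc a b) := by
    refine Measure.eqOn_Icc_of_ae_eq volume hab.ne ?_ (hY.norm.pow 2)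
      (continuousOn_const.add ((continuousOn_integral_Icc hab.le hpair).const_smul (2 : ℝ)))
    rw [restrict_Ioo_eq_restrict_Icc.symm]
    filter_upwards [henergy, hYy] with t ht hYt
    rw [hYt, ht]
  have hleft := left_mem_Icc.2 hab.le
  have hsplit := intervalIntegral.integral_interval_sub_left
    (intervalIntegrable_of_integrableOn_Ioo hpair hleft ht)
    (intervalIntegrable_of_integrableOn_Ioo hpair hleft hs)
  have hs' := heq hs
  have ht' := heq ht
  simp only at hs' ht'
  linarith

theorem mul_normSq_le_integral (hab : a < b) (hy : MemLp y 2 (volume.restrict (Ioo a b)))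
    (hg : MemLp g 2 (volume.restrict (Ioo a b)))
    (hyg : ∀ᵐ t ∂volume.restrict (Ioo a b), pivot ι (y t) = c + ∫ s in a..t, g s) {Y : ℝ → 𝓗}
    (hY : ContinuousOn Y (Icc a b)) (hYy : ∀ᵐ t ∂volume.restrict (Ioo a b), Y t = ι (y t)) :
    (b - a) * ‖Y b‖ ^ 2
      ≤ (∫ t in Ioo a b, ‖Y t‖ ^ 2) + (b - a) * ∫ t in Ioo a b, (‖y t‖ ^ 2 + ‖g t‖ ^ 2) := by
  have hsum := integrableOn_normSq_add_normSq hy hg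
  obtain ⟨s, -, hs, hmean⟩ := exists_mem_mul_le_integral (A := univ) (e := fun t => ‖Y t‖ ^ 2)
    hab ((hY.norm.pow 2).integrableOn_Icc.mono_set Ioo_subset_Icc_self) (by simp)
  have hpairing : 2 * ∫ r in s..b, g r (y r) ≤ ∫ t in Ioo a b, (‖y t‖ ^ 2 + ‖g t‖ ^ 2) := by
    rw [intervalIntegral.integral_of_le hs.2.le, integral_Ioc_eq_integral_Ioo,
      ← integral_const_mul]
    refine (setIntegral_mono_on (((integrable_pairing hg hy).mono_measure
      (Measure.restrict_mono (Ioo_subset_Ioo_left hs.1.le) le_rfl)).const_mul 2)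
      (hsum.mono_set (Ioo_subset_Ioo_left hs.1.le)) measurableSet_Ioo fun t _ => ?_).trans
      (setIntegral_mono_set hsum (Eventually.of_forall fun t => by positivity)
        (Ioo_subset_Ioo_left hs.1.le).eventuallyLE)
    linarith [(le_abs_self _).trans ((g t).le_opNorm (y t)), two_mul_le_add_sq ‖y t‖ ‖g t‖]
  rw [intervalIntegral.integral_of_le hab.le, integral_Ioc_eq_integral_Ioo] at hmean
  have henergy := normSq_sub_normSq_eq_integral hab hy hg hyg hY hYy (Ioo_subset_Icc_self hs)
    (right_mem_Icc.2 hab.le)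
  nlinarith

end ContinuousRepresentative

section SobolevEmbedding

theorem norm_sq_eq_integral {α E : Type*} [MeasurableSpace α] {μ : Measure α} [NormedAddCommGroup E]
    (f : Lp E 2 μ) : ‖f‖ ^ 2 = ∫ t, ‖f t‖ ^ 2 ∂μ := by
  have hnonneg : 0 ≤ ∫ t, ‖f t‖ ^ 2 ∂μ := by positivity
  rw [Lp.norm_def, (Lp.memLp f).eLpNorm_eq_integral_rpow_norm (by simp) (by simp)]
  simp only [ENNReal.toReal_ofNat, Real.rpow_ofNat]
  rw [ENNReal.toReal_ofReal (by positivity), ← Real.rpow_natCast, ← Real.rpow_mul hnonneg]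
  norm_num

theorem integral_norm_le_norm_of_measure_eq_one {α E : Type*} [MeasurableSpace α] {μ : Measure α}
    [NormedAddCommGroup E] {p : ℝ≥0∞} (hp : 1 ≤ p) {s : Set α} (hs : μ s = 1) (f : Lp E p μ) :
    ∫ x in s, ‖f x‖ ∂μ ≤ ‖f‖ := by
  have : IsProbabilityMeasure (μ.restrict s) := ⟨by rw [Measure.restrict_apply_univ, hs]⟩
  rw [integral_norm_eq_lintegral_enorm (Lp.aestronglyMeasurable f).restrict,
    ← eLpNorm_one_eq_lintegral_enorm, Lp.norm_def]
  exact ENNReal.toReal_mono (Lp.eLpNorm_ne_top f)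
    ((eLpNorm_le_eLpNorm_of_exponent_le hp (Lp.aestronglyMeasurable f).restrict).trans
      (eLpNorm_mono_measure f Measure.restrict_le_self))

theorem HasWeakDerivOn.ae_mul_norm_le {E : Type*} [NormedAddCommGroup E] [NormedSpace ℝ E]
    [CompleteSpace E] {a b : ℝ} {f g : ℝ → E} (hab : a < b) (hf : IntegrableOn f (Ioo a b))
    (hg : IntegrableOn g (Ioo a b)) (h : HasWeakDerivOn (Ioo a b) f g) :
    ∀ᵐ x ∂volume.restrict (Ioo a b),
      (b - a) * ‖f x‖ ≤ (∫ t in Ioo a b, ‖f t‖) + (b - a) * ∫ t in Ioo a b, ‖g t‖ := by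
  obtain ⟨c, hc⟩ := h.ae_eq_primitive hab hf hg
  have hint {t : ℝ} (ht : t ∈ Ioo a b) : IntervalIntegrable g volume a t :=
    intervalIntegrable_of_integrableOn_Ioo hg (left_mem_Icc.2 hab.le) (Ioo_subset_Icc_self ht)
  filter_upwards [hc, ae_restrict_mem measurableSet_Ioo] with x hx hxab
  have hosc : ∀ᵐ t ∂volume.restrict (Ioo a b), ‖f x‖ ≤ ‖f t‖ + ∫ s in Ioo a b, ‖g s‖ := by
    filter_upwards [hc, ae_restrict_mem measurableSet_Ioo] with t ht htab
    have hdiff : f x - f t = ∫ s in t..x, g s := by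
      rw [hx, ht, add_sub_add_left_eq_sub,
        intervalIntegral.integral_interval_sub_left (hint hxab) (hint htab)]
    have hle : ‖f x - f t‖ ≤ ∫ s in Ioo a b, ‖g s‖ := by
      rw [hdiff]
      refine intervalIntegral.norm_integral_le_integral_norm_uIoc.trans
        (setIntegral_mono_set hg.norm (Eventually.of_forall fun s => norm_nonneg _)
          (LE.le.eventuallyLE fun s hs => ?_))
      exact ⟨(lt_min htab.1 hxab.1).trans hs.1, hs.2.trans_lt (max_lt htab.2 hxab.2)⟩
    linarith [norm_le_norm_add_norm_sub (f t) (f x), norm_sub_rev (f x) (f t)]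
  have hconst (r : ℝ) : IntegrableOn (fun _ : ℝ => r) (Ioo a b) := integrableOn_const (by simp)
  have hmean := integral_mono_ae (hconst ‖f x‖) (Integrable.fun_add hf.norm (hconst _)) hosc
  rwa [integral_add hf.norm (hconst _), setIntegral_const, setIntegral_const,
    Real.volume_real_Ioo_of_le hab.le, smul_eq_mul, smul_eq_mul] at hmean

theorem HasWeakDeriv.hasWeakDerivOn {u g : H} (h : HasWeakDeriv u g) (U : Set ℝ) :
    HasWeakDerivOn U u g := fun η hη => by
  rw [hη.deriv.setIntegral_smul, hη.setIntegral_smul]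
  simpa only [smul_eq_mul, mul_comm] using h η hη.contDiff hη.hasCompactSupport

theorem V.norm_sq_eq (v : V) : ‖v‖ ^ 2 = ‖V.val v‖ ^ 2 + ‖V.dx v‖ ^ 2 :=
  WithLp.prod_norm_sq_eq_of_L2 v.1

theorem V.norm_val_le (v : V) : ‖V.val v‖ ≤ ‖v‖ :=
  le_of_sq_le_sq (by rw [v.norm_sq_eq]; exact le_add_of_nonneg_right (sq_nonneg _)) (norm_nonneg _)

theorem V.norm_dx_le (v : V) : ‖V.dx v‖ ≤ ‖v‖ :=
  le_of_sq_le_sq (by rw [v.norm_sq_eq]; exact le_add_of_nonneg_left (sq_nonneg _)) (norm_nonneg _)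

theorem V.ae_norm_val_apply_le (v : V) : ∀ᵐ x, ‖V.val v x‖ ≤ 2 * ‖v‖ := by
  have hunit (n : ℤ) : ∀ᵐ x ∂volume.restrict (Ico (n : ℝ) (n + 1)), ‖V.val v x‖ ≤ 2 * ‖v‖ := by
    have hlength : volume (Ioo (n : ℝ) (n + 1)) = 1 := by simp
    have hint (f : H) : IntegrableOn f (Ioo (n : ℝ) (n + 1)) :=
      ((Lp.memLp f).restrict _).integrable one_le_two
    rw [Measure.restrict_congr_set Ioo_ae_eq_Ico.symm]
    have hweak : HasWeakDerivOn (Ioo (n : ℝ) (n + 1)) (V.val v) (V.dx v) :=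
      HasWeakDeriv.hasWeakDerivOn v.2 _
    filter_upwards [hweak.ae_mul_norm_le (lt_add_one _) (hint _) (hint _)] with x hx
    have hval := integral_norm_le_norm_of_measure_eq_one one_le_two hlength (V.val v)
    have hdx := integral_norm_le_norm_of_measure_eq_one one_le_two hlength (V.dx v)
    rw [add_sub_cancel_left, one_mul, one_mul] at hx
    linarith [v.norm_val_le, v.norm_dx_le]
  have hcover := (ae_restrict_iUnion_iff _ _).2 hunit
  rwa [iUnion_Ico_intCast, Measure.restrict_univ] at hcover

theorem V.memLp_top (v : V) : MemLp (V.val v) ∞ :=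
  memLp_top_of_bound (Lp.aestronglyMeasurable _) _ v.ae_norm_val_apply_le

/-- The Sobolev embedding `H¹(ℝ) → L^∞(ℝ)`. -/
def V.toLinfty : V →L[ℝ] Lp ℝ ∞ (volume : Measure ℝ) :=
  LinearMap.mkContinuous
    { toFun v := v.memLp_top.toLp
      map_add' u v := by
        rw [← MemLp.toLp_add]
        exact MemLp.toLp_congr _ _ (by rw [map_add]; exact Lp.coeFn_add _ _)
      map_smul' r v := by
        rw [RingHom.id_apply, ← MemLp.toLp_const_smul]
        exact MemLp.toLp_congr _ _ (by rw [map_smul]; exact Lp.coeFn_smul _ _) }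
    2 fun v => (Lp.norm_toLp _ v.memLp_top).trans_le (ENNReal.toReal_le_of_le_ofReal (by positivity)
      (eLpNorm_exponent_top.trans_le (eLpNormEssSup_le_of_ae_bound v.ae_norm_val_apply_le)))

theorem V.norm_toLinfty_le (v : V) : ‖V.toLinfty v‖ ≤ 2 * ‖v‖ :=
  V.toLinfty.le_of_opNorm_le (LinearMap.mkContinuous_norm_le _ zero_le_two _) v

theorem V.coeFn_toLinfty (v : V) : V.toLinfty v =ᵐ[volume] V.val v :=
  v.memLp_top.coeFn_toLp

end SobolevEmbedding

section Convection

/-- The convection form `(u, v, φ) ↦ ∫ u v φ` on `H¹(ℝ) × L²(ℝ) × L²(ℝ)`. -/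
def convection : V →L[ℝ] H →L[ℝ] H →L[ℝ] ℝ :=
  ((ContinuousLinearMap.compL ℝ H H (StrongDual ℝ H) (innerSL ℝ)).comp
    ((ContinuousLinearMap.mul ℝ ℝ).holderL volume ∞ 2 2)).comp V.toLinfty

theorem convection_apply (u : V) (v φ : H) :
    convection u v φ = ∫ x, V.val u x * v x * φ x := by
  refine (L2.inner_def _ _).trans (integral_congr_ae ?_)
  filter_upwards [(ContinuousLinearMap.mul ℝ ℝ).coeFn_holder (r := 2) (V.toLinfty u) v,
    u.coeFn_toLinfty] with x hx hu
  change inner ℝ ((ContinuousLinearMap.mul ℝ ℝ).holder 2 (V.toLinfty u) v x) (φ x) = _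
  rw [hx, hu, RCLike.inner_apply, conj_trivial, mul_comm, ContinuousLinearMap.mul_apply']

theorem norm_convection_le (u : V) (v φ : H) : ‖convection u v φ‖ ≤ 2 * ‖u‖ * ‖v‖ * ‖φ‖ := by
  have hproduct : ‖(ContinuousLinearMap.mul ℝ ℝ).holder 2 (V.toLinfty u) v‖ ≤ 2 * ‖u‖ * ‖v‖ := by
    refine ((ContinuousLinearMap.mul ℝ ℝ).norm_holder_apply_apply_le _ _).trans ?_
    rw [ContinuousLinearMap.opNorm_mul, one_mul]
    gcongr
    exact u.norm_toLinfty_le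
  exact (norm_inner_le_norm _ φ).trans (mul_le_mul_of_nonneg_right hproduct (norm_nonneg φ))

end Convection

section EvolutionSpace

variable {T : ℝ}

theorem HasTimeDeriv.hasWeakDerivOn {y : L2V T} {g : L2VDual T} (h : HasTimeDeriv T y g) :
    HasWeakDerivOn (Ioo 0 T) (fun t => pivot V.val (y t)) g := fun η hη => by
  have hy : IntegrableOn (fun t => pivot V.val (y t)) (Ioo 0 T) :=
    (pivot V.val).integrable_comp ((Lp.memLp y).integrable one_le_two)
  have hg : IntegrableOn g (Ioo 0 T) := (Lp.memLp g).integrable one_le_two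
  ext φ
  rw [neg_apply, ContinuousLinearMap.integral_apply (hη.deriv.integrableOn_smul hy),
    ContinuousLinearMap.integral_apply (hη.integrableOn_smul hg)]
  exact h η hη.contDiff hη.hasCompactSupport hη.tsupport_subset φ

namespace W

theorem ae_pivot_eq_primitive (hT : 0 < T) (y : W T) :
    ∃ c : VDual, ∀ᵐ t ∂timeMeasure T,
      pivot V.val (y.toL2V t) = c + ∫ s in (0 : ℝ)..t, y.dt s :=
  have hy : HasTimeDeriv T y.toL2V y.dt := y.2
  hy.hasWeakDerivOn.ae_eq_primitive hT
    ((pivot V.val).integrable_comp ((Lp.memLp y.toL2V).integrable one_le_two))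
    ((Lp.memLp y.dt).integrable one_le_two)

theorem isContRep_valueAt (hT : 0 < T) (y : W T) : IsContRep y y.valueAt := by
  obtain ⟨c, hc⟩ := y.ae_pivot_eq_primitive hT
  have hexists : ∃ Y, IsContRep y Y :=
    exists_continuousOn_Icc_ae_eq hT (Lp.memLp _) (Lp.memLp _) hc
  rw [show y.valueAt = hexists.choose from funext fun t => dif_pos hexists]
  exact hexists.choose_spec

theorem toL2V_sub (y z : W T) : (y - z).toL2V = y.toL2V - z.toL2V := rfl

theorem dt_sub (y z : W T) : (y - z).dt = y.dt - z.dt := rfl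

theorem valueAt_sub (hT : 0 < T) (y z : W T) {t : ℝ} (ht : t ∈ Icc 0 T) :
    (y - z).valueAt t = y.valueAt t - z.valueAt t := by
  obtain ⟨hycont, hy⟩ := y.isContRep_valueAt hT
  obtain ⟨hzcont, hz⟩ := z.isContRep_valueAt hT
  obtain ⟨hcont, hsub⟩ := (y - z).isContRep_valueAt hT
  refine Measure.eqOn_Icc_of_ae_eq volume hT.ne ?_ hcont (hycont.sub hzcont) ht
  rw [restrict_Ioo_eq_restrict_Icc.symm]
  filter_upwards [hy, hz, hsub, Lp.coeFn_sub y.toL2V z.toL2V] with t hyt hzt hsubt hcoe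
  rw [hsubt, toL2V_sub, hcoe, Pi.sub_apply, Pi.sub_apply, map_sub, hyt, hzt]

theorem normSq_valueAt_sub_eq_integral (hT : 0 < T) (y : W T) {s t : ℝ} (hs : s ∈ Icc 0 T)
    (ht : t ∈ Icc 0 T) :
    ‖y.valueAt t‖ ^ 2 - ‖y.valueAt s‖ ^ 2 = 2 * ∫ r in s..t, y.dt r (y.toL2V r) := by
  obtain ⟨c, hc⟩ := y.ae_pivot_eq_primitive hT
  obtain ⟨hcont, hae⟩ := y.isContRep_valueAt hT
  exact normSq_sub_normSq_eq_integral hT (Lp.memLp _) (Lp.memLp _) hc hcont hae hs ht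

theorem norm_sq_eq (y : W T) : ‖y‖ ^ 2 = ‖y.toL2V‖ ^ 2 + ‖y.dt‖ ^ 2 :=
  WithLp.prod_norm_sq_eq_of_L2 y.1

theorem norm_toL2V_le (y : W T) : ‖y.toL2V‖ ≤ ‖y‖ :=
  le_of_sq_le_sq (by rw [y.norm_sq_eq]; exact le_add_of_nonneg_right (sq_nonneg _)) (norm_nonneg _)

theorem norm_valueAt_le (hT : 0 < T) (y : W T) : ‖y.valueAt T‖ ≤ √((1 + T) / T) * ‖y‖ := by
  obtain ⟨c, hc⟩ := y.ae_pivot_eq_primitive hT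
  obtain ⟨hcont, hae⟩ := y.isContRep_valueAt hT
  have htrace := mul_normSq_le_integral hT (Lp.memLp y.toL2V) (Lp.memLp y.dt) hc hcont hae
  have hy := (Lp.memLp y.toL2V).integrable_norm_pow two_ne_zero
  have hdt := (Lp.memLp y.dt).integrable_norm_pow two_ne_zero
  have hvalue : ∫ t in Ioo 0 T, ‖y.valueAt t‖ ^ 2 ≤ ∫ t in Ioo 0 T, ‖y.toL2V t‖ ^ 2 := by
    refine integral_mono_of_nonneg (Eventually.of_forall fun t => by positivity) hy ?_
    filter_upwards [hae] with t ht
    rw [ht]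
    gcongr
    exact V.norm_val_le _
  rw [integral_add hy hdt, ← norm_sq_eq_integral, ← norm_sq_eq_integral, ← y.norm_sq_eq,
    sub_zero] at htrace
  rw [← norm_sq_eq_integral] at hvalue
  have htoL2V := pow_le_pow_left₀ (norm_nonneg _) y.norm_toL2V_le 2
  refine le_of_sq_le_sq ?_ (by positivity)
  rw [mul_pow, Real.sq_sqrt (by positivity), div_mul_eq_mul_div, le_div_iff₀ hT]
  linarith

theorem norm_valueAt_le_of_ae (hT : 0 < T) {y : W T} {r : ℝ}
    (h : ∀ᵐ t ∂timeMeasure T, ‖y.toL2V t‖ ≤ r) {t : ℝ} (ht : t ∈ Icc 0 T) :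
    ‖y.valueAt t‖ ≤ r := by
  obtain ⟨hcont, hae⟩ := y.isContRep_valueAt hT
  refine max_eq_right_iff.1 (Measure.eqOn_Icc_of_ae_eq volume hT.ne
    (f := fun t => max ‖y.valueAt t‖ r) (g := fun _ => r) ?_
    (hcont.norm.sup continuousOn_const) continuousOn_const ht)
  rw [restrict_Ioo_eq_restrict_Icc.symm]
  filter_upwards [hae, h] with t hvalue hr
  rw [hvalue]
  exact max_eq_right ((V.norm_val_le _).trans hr)

theorem ae_norm_le_of_normLinftyV_le {y : W T} {M : ℝ} (h : y.normLinftyV ≤ ENNReal.ofReal M) :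
    ∀ᵐ t ∂timeMeasure T, ‖y.toL2V t‖ ≤ |M| := by
  filter_upwards [ae_le_eLpNormEssSup (f := y.toL2V) (μ := timeMeasure T)] with t ht
  rw [← eLpNorm_exponent_top] at ht
  have hM := (ht.trans h).trans (ENNReal.ofReal_le_ofReal (le_abs_self M))
  rwa [← ofReal_norm, ENNReal.ofReal_le_ofReal_iff (abs_nonneg M)] at hM

theorem exists_bound_toL2V_valueAt (hT : 0 < T) (M : ℝ) :
    ∃ R : ℝ, ∀ y : W T, y.normLinftyV ≤ ENNReal.ofReal M ∨ ‖y‖ ≤ M →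
      ‖y.toL2V‖ ≤ R ∧ ‖y.valueAt T‖ ≤ R := by
  let κ : ℝ := measureUnivNNReal (timeMeasure T) ^ (2 : ℝ≥0∞).toReal⁻¹
  refine ⟨max (max (κ * |M|) |M|) (max M (√((1 + T) / T) * M)), fun y hy => ?_⟩
  simp only [le_max_iff]
  rcases hy with hy | hy
  · have hae := ae_norm_le_of_normLinftyV_le hy
    exact ⟨.inl (.inl (Lp.norm_le_of_ae_bound (abs_nonneg M) hae)),
      .inl (.inr (norm_valueAt_le_of_ae hT hae (right_mem_Icc.2 hT.le)))⟩
  · have hvalue := (y.norm_valueAt_le hT).trans (mul_le_mul_of_nonneg_left hy (Real.sqrt_nonneg _))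
    exact ⟨.inr (.inl (y.norm_toL2V_le.trans hy)), .inr (.inr hvalue)⟩

end W

end EvolutionSpace

section Gronwall

theorem absolutelyContinuousOnInterval_comp {X Y : Type*} [PseudoMetricSpace X]
    [PseudoMetricSpace Y] {f : ℝ → X} {g : X → Y} {s : Set X} {C : NNReal} {a b : ℝ}
    (hg : LipschitzOnWith C g s) (hf : AbsolutelyContinuousOnInterval f a b)
    (hfs : MapsTo f (uIcc a b) s) : AbsolutelyContinuousOnInterval (g ∘ f) a b := by
  rw [absolutelyContinuousOnInterval_iff] at hf ⊢
  intro ε hε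
  obtain ⟨δ, hδ, hsmall⟩ := hf (ε / (C + 1)) (by positivity)
  refine ⟨δ, hδ, fun E hE hlength => ?_⟩
  calc ∑ i ∈ Finset.range E.1, dist (g (f (E.2 i).1)) (g (f (E.2 i).2))
      ≤ ∑ i ∈ Finset.range E.1, (C + 1) * dist (f (E.2 i).1) (f (E.2 i).2) :=
        Finset.sum_le_sum fun i hi =>
          (hg.dist_le_mul _ (hfs (hE.1 i hi).1) _ (hfs (hE.1 i hi).2)).trans
            (mul_le_mul_of_nonneg_right (le_add_of_nonneg_right zero_le_one) dist_nonneg)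
    _ < ε := by
        rw [← Finset.mul_sum, ← lt_div_iff₀' (by positivity)]
        exact hsmall E hE hlength

theorem lipschitzOnWith_exp_Iic : LipschitzOnWith 1 Real.exp (Iic 0) :=
  (convex_Iic 0).lipschitzOnWith_of_nnnorm_deriv_le (fun _ _ => Real.differentiableAt_exp)
    fun x hx => by
      rw [Real.deriv_exp, ← NNReal.coe_le_coe, coe_nnnorm, Real.norm_eq_abs, Real.abs_exp]
      exact Real.exp_le_one_iff.2 hx

theorem le_of_ae_hasDerivAt_nonneg {f f' : ℝ → ℝ} {a b : ℝ} (hab : a ≤ b)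
    (hf : AbsolutelyContinuousOnInterval f a b)
    (h : ∀ᵐ x, x ∈ uIcc a b → HasDerivAt f (f' x) x ∧ 0 ≤ f' x) : f a ≤ f b := by
  rw [← sub_nonneg, ← hf.integral_deriv_eq_sub]
  refine intervalIntegral.integral_nonneg_of_ae_restrict hab ?_
  filter_upwards [ae_restrict_of_ae h, ae_restrict_mem measurableSet_Icc] with x hx hxab
  obtain ⟨hderiv, hnonneg⟩ := hx (Icc_subset_uIcc hxab)
  rwa [hderiv.deriv]

-- The integrating factor `exp (-∫ r in s..b, a r)` makes the right-hand side of `hle` monotone.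
theorem gronwall_backward {a e : ℝ → ℝ} {t b K : ℝ} (htb : t ≤ b)
    (ha : IntervalIntegrable a volume t b)
    (hae : IntervalIntegrable (fun s => a s * e s) volume t b) (ha0 : ∀ s, 0 ≤ a s)
    (hle : ∀ s ∈ Icc t b, e s ≤ K + ∫ r in s..b, a r * e r) :
    K + ∫ r in t..b, a r * e r ≤ K * Real.exp (∫ r in t..b, a r) := by
  let A s := ∫ r in b..s, a r
  let G s := K - ∫ r in b..s, a r * e r
  have hA0 : MapsTo A (uIcc t b) (Iic 0) := fun s hs => by
    rw [uIcc_of_le htb] at hs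
    exact (intervalIntegral.integral_symm _ _).trans_le
      (neg_nonpos.2 (intervalIntegral.integral_nonneg hs.2 fun r _ => ha0 r))
  have hA : AbsolutelyContinuousOnInterval A t b :=
    ha.absolutelyContinuousOnInterval_intervalIntegral right_mem_uIcc
  have hG : AbsolutelyContinuousOnInterval G t b :=
    (LipschitzWith.const K).lipschitzOnWith.absolutelyContinuousOnInterval.sub
      (hae.absolutelyContinuousOnInterval_intervalIntegral right_mem_uIcc)
  have hmono : G t * Real.exp (A t) ≤ G b * Real.exp (A b) := by
    refine le_of_ae_hasDerivAt_nonneg htb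
      (hG.mul (absolutelyContinuousOnInterval_comp lipschitzOnWith_exp_Iic hA hA0)) (f' := fun s =>
        -(a s * e s) * Real.exp (A s) + G s * (Real.exp (A s) * a s)) ?_
    filter_upwards [ha.ae_hasDerivAt_integral, hae.ae_hasDerivAt_integral] with s hsA hsG hs
    refine ⟨((hsG hs b right_mem_uIcc).const_sub K).mul (hsA hs b right_mem_uIcc).exp, ?_⟩
    have hes : e s ≤ G s := by
      simpa only [G, intervalIntegral.integral_symm s b, sub_neg_eq_add] using
        hle s (uIcc_of_le htb ▸ hs)
    nlinarith [mul_nonneg (mul_nonneg (ha0 s) (Real.exp_nonneg (A s))) (sub_nonneg.2 hes)]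
  simp only [G, A, intervalIntegral.integral_same, sub_zero, Real.exp_zero, mul_one,
    intervalIntegral.integral_symm t b, sub_neg_eq_add, Real.exp_neg] at hmono
  rwa [← div_eq_mul_inv, div_le_iff₀ (Real.exp_pos _)] at hmono

end Gronwall

section AdjointEquation

theorem ae_eq_of_forall_ae_apply_eq {α 𝕜 X Y : Type*} [MeasurableSpace α] {μ : Measure α}
    [Semiring 𝕜] [AddCommMonoid X] [TopologicalSpace X] [TopologicalSpace.SeparableSpace X]
    [AddCommMonoid Y] [TopologicalSpace Y] [T2Space Y] [Module 𝕜 X] [Module 𝕜 Y]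
    {L L' : α → X →L[𝕜] Y}
    (h : ∀ x, ∀ᵐ t ∂μ, L t x = L' t x) : ∀ᵐ t ∂μ, L t = L' t := by
  filter_upwards [ae_all_iff.2 fun n => h (TopologicalSpace.denseSeq X n)] with t ht
  exact DFunLike.coe_injective ((TopologicalSpace.denseRange_denseSeq X).equalizer
    (L t).continuous (L' t).continuous (funext ht))

instance : SecondCountableTopology V := by
  have : Fact ((2 : ℝ≥0∞) ≠ ⊤) := ⟨ENNReal.ofNat_ne_top⟩
  exact inferInstanceAs (SecondCountableTopology sobolevGraph)

variable {ν T : ℝ}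

/-- The adjoint equation with a source term, `∂ₜ q + y ∂ₓ q + w ∂ₓ ρ + ν ∂ₓ² q = 0`, as an identity
in `V*` for almost every time. With `w = 0` it is the adjoint equation; the difference of two
adjoint solutions solves it with `w ≠ 0`. -/
def SolvesAdjointEq (ν : ℝ) (y w ρ : L2V T) (q : W T) : Prop :=
  ∀ᵐ t ∂timeMeasure T, q.dt t = ν • pivot V.dx (q.toL2V t) -
    (convection (y t) (V.dx (q.toL2V t)) + convection (w t) (V.dx (ρ t))).comp V.val

namespace IsAdjointSolution

variable {y_d : H} {y y₁ y₂ p p₁ p₂ : W T}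

theorem valueAt_eq (h : IsAdjointSolution ν T y_d y p) : p.valueAt T = y_d - y.valueAt T :=
  ext_inner_right ℝ h.terminal

theorem ae_dt_eq (h : IsAdjointSolution ν T y_d y p) :
    ∀ᵐ t ∂timeMeasure T, p.dt t = ν • pivot V.dx (p.toL2V t) -
      (convection (y.toL2V t) (V.dx (p.toL2V t))).comp V.val := by
  refine ae_eq_of_forall_ae_apply_eq fun φ => ?_
  filter_upwards [h.equation φ] with t ht
  rw [← convection_apply] at ht
  exact eq_sub_of_add_eq (sub_eq_zero.1 ht)

theorem solvesAdjointEq (h : IsAdjointSolution ν T y_d y p) :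
    SolvesAdjointEq ν y.toL2V 0 0 p := by
  filter_upwards [h.ae_dt_eq, Lp.coeFn_zero V 2 (timeMeasure T)] with t ht hzero
  rw [ht, hzero, Pi.zero_apply, map_zero, map_zero, map_zero, add_zero]

theorem solvesAdjointEq_sub (h₁ : IsAdjointSolution ν T y_d y₁ p₁)
    (h₂ : IsAdjointSolution ν T y_d y₂ p₂) :
    SolvesAdjointEq ν y₁.toL2V (y₁.toL2V - y₂.toL2V) p₂.toL2V (p₁ - p₂) := by
  filter_upwards [h₁.ae_dt_eq, h₂.ae_dt_eq, Lp.coeFn_sub p₁.dt p₂.dt,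
    Lp.coeFn_sub p₁.toL2V p₂.toL2V, Lp.coeFn_sub y₁.toL2V y₂.toL2V] with t h₁t h₂t hdt hp hy
  rw [W.dt_sub, W.toL2V_sub, hdt, hp, hy]
  simp only [Pi.sub_apply, h₁t, h₂t, map_sub, sub_apply, ContinuousLinearMap.add_comp,
    ContinuousLinearMap.sub_comp, smul_sub]
  abel

end IsAdjointSolution

end AdjointEquation

section EnergyEstimate

variable {ν T : ℝ} {y w ρ : L2V T} {q : W T}

theorem four_mul_le_mul_sq_add (hν : 0 < ν) (a b : ℝ) :
    4 * (a * b) ≤ ν * a ^ 2 + 4 / ν * b ^ 2 := by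
  have hsquare : ν * a ^ 2 + 4 / ν * b ^ 2 - 4 * (a * b) = ν * (a - 2 / ν * b) ^ 2 := by
    field_simp
    ring
  rw [← sub_nonneg, hsquare]
  positivity

/-- The coefficient of `‖q(t)‖_H²` in the energy inequality for `SolvesAdjointEq ν y w ρ q`, to
which Gronwall's inequality is applied. -/
def energyCoeff (ν : ℝ) (y ρ : L2V T) (t : ℝ) : ℝ :=
  4 / ν * ‖y t‖ ^ 2 + 4 * ‖ρ t‖ ^ 2

theorem integrable_energyCoeff (ν : ℝ) (y ρ : L2V T) :
    Integrable (energyCoeff ν y ρ) (timeMeasure T) :=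
  (((Lp.memLp y).integrable_norm_pow two_ne_zero).const_mul _).add
    (((Lp.memLp ρ).integrable_norm_pow two_ne_zero).const_mul _)

theorem integral_energyCoeff (ν : ℝ) (y ρ : L2V T) :
    ∫ t in Ioo 0 T, energyCoeff ν y ρ t = 4 / ν * ‖y‖ ^ 2 + 4 * ‖ρ‖ ^ 2 := by
  simp only [energyCoeff]
  rw [integral_add (((Lp.memLp y).integrable_norm_pow two_ne_zero).const_mul _)
    (((Lp.memLp ρ).integrable_norm_pow two_ne_zero).const_mul _), integral_const_mul,
    integral_const_mul, norm_sq_eq_integral, norm_sq_eq_integral]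

theorem energyCoeff_nonneg (hν : 0 < ν) (y ρ : L2V T) (t : ℝ) : 0 ≤ energyCoeff ν y ρ t := by
  unfold energyCoeff
  positivity

theorem integrable_norm_dx_sq (y : L2V T) :
    Integrable (fun t => ‖V.dx (y t)‖ ^ 2) (timeMeasure T) :=
  (V.dx.comp_memLp' (Lp.memLp y)).integrable_norm_pow two_ne_zero

theorem W.intervalIntegrable_energyCoeff_mul (hT : 0 < T) (q : W T) (ν : ℝ) (y ρ : L2V T) {s : ℝ}
    (hs : s ∈ Icc 0 T) :
    IntervalIntegrable (fun r => energyCoeff ν y ρ r * ‖q.valueAt r‖ ^ 2) volume s T := by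
  refine (intervalIntegrable_of_integrableOn_Ioo (integrable_energyCoeff ν y ρ) hs
    (right_mem_Icc.2 hT.le)).mul_continuousOn ?_
  rw [uIcc_of_le hs.2]
  exact ((q.isContRep_valueAt hT).1.mono (Icc_subset_Icc_left hs.1)).norm.pow 2

namespace SolvesAdjointEq

theorem ae_energy_le (h : SolvesAdjointEq ν y w ρ q) (hν : 0 < ν) :
    ∀ᵐ t ∂timeMeasure T, ν * ‖V.dx (q.toL2V t)‖ ^ 2 ≤ 2 * q.dt t (q.toL2V t) +
      energyCoeff ν y ρ t * ‖V.val (q.toL2V t)‖ ^ 2 + ‖w t‖ ^ 2 := by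
  filter_upwards [h] with t ht
  have hidentity : q.dt t (q.toL2V t) = ν * ‖V.dx (q.toL2V t)‖ ^ 2 -
      (convection (y t) (V.dx (q.toL2V t)) (V.val (q.toL2V t)) +
        convection (w t) (V.dx (ρ t)) (V.val (q.toL2V t))) := by
    rw [ht, ← real_inner_self_eq_norm_sq]
    rfl
  have htransport := (Real.le_norm_self _).trans
    (norm_convection_le (y t) (V.dx (q.toL2V t)) (V.val (q.toL2V t)))
  have hsource : convection (w t) (V.dx (ρ t)) (V.val (q.toL2V t)) ≤
      2 * ‖w t‖ * ‖ρ t‖ * ‖V.val (q.toL2V t)‖ := by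
    refine ((Real.le_norm_self _).trans (norm_convection_le _ _ _)).trans ?_
    gcongr
    exact V.norm_dx_le _
  have hyoung_transport := four_mul_le_mul_sq_add hν ‖V.dx (q.toL2V t)‖
    (‖y t‖ * ‖V.val (q.toL2V t)‖)
  have hyoung_source := four_mul_le_mul_sq_add one_pos ‖w t‖ (‖ρ t‖ * ‖V.val (q.toL2V t)‖)
  rw [energyCoeff]
  linarith

theorem normSq_valueAt_add_le (h : SolvesAdjointEq ν y w ρ q) (hν : 0 < ν) (hT : 0 < T) {s : ℝ}
    (hs : s ∈ Icc 0 T) :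
    ‖q.valueAt s‖ ^ 2 + ν * ∫ r in s..T, ‖V.dx (q.toL2V r)‖ ^ 2 ≤
      ‖q.valueAt T‖ ^ 2 + ‖w‖ ^ 2 + ∫ r in s..T, energyCoeff ν y ρ r * ‖q.valueAt r‖ ^ 2 := by
  have hT' : T ∈ Icc 0 T := right_mem_Icc.2 hT.le
  have hdx := intervalIntegrable_of_integrableOn_Ioo (integrable_norm_dx_sq q.toL2V) hs hT'
  have hpairing := intervalIntegrable_of_integrableOn_Ioo
    (integrable_pairing (Lp.memLp q.dt) (Lp.memLp q.toL2V)) hs hT'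
  have hcoeff := q.intervalIntegrable_energyCoeff_mul hT ν y ρ hs
  have hw := (Lp.memLp w).integrable_norm_pow two_ne_zero
  have hwint := intervalIntegrable_of_integrableOn_Ioo hw hs hT'
  have hmono : ∫ r in s..T, ν * ‖V.dx (q.toL2V r)‖ ^ 2 ≤
      ∫ r in s..T, (2 * q.dt r (q.toL2V r) +
        energyCoeff ν y ρ r * ‖q.valueAt r‖ ^ 2 + ‖w r‖ ^ 2) := by
    refine intervalIntegral.integral_mono_ae_restrict hs.2 (hdx.const_mul ν)
      (((hpairing.const_mul 2).add hcoeff).add hwint) ?_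
    rw [restrict_Ioo_eq_restrict_Icc.symm]
    refine ae_restrict_of_ae_restrict_of_subset (Ioo_subset_Ioo_left hs.1) ?_
    filter_upwards [h.ae_energy_le hν, (q.isContRep_valueAt hT).2] with r hr hvalue
    rwa [hvalue]
  have hwle : ∫ r in s..T, ‖w r‖ ^ 2 ≤ ‖w‖ ^ 2 := by
    rw [norm_sq_eq_integral, intervalIntegral.integral_of_le hs.2, integral_Ioc_eq_integral_Ioo]
    exact setIntegral_mono_set hw (Eventually.of_forall fun r => by positivity)
      (LE.le.eventuallyLE (Ioo_subset_Ioo_left hs.1))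
  rw [intervalIntegral.integral_add ((hpairing.const_mul 2).add hcoeff) hwint,
    intervalIntegral.integral_add (hpairing.const_mul 2) hcoeff,
    intervalIntegral.integral_const_mul, intervalIntegral.integral_const_mul,
    ← q.normSq_valueAt_sub_eq_integral hT hs hT'] at hmono
  linarith

theorem energy_le (h : SolvesAdjointEq ν y w ρ q) (hν : 0 < ν) (hT : 0 < T) {s : ℝ}
    (hs : s ∈ Icc 0 T) :
    ‖q.valueAt s‖ ^ 2 + ν * ∫ r in s..T, ‖V.dx (q.toL2V r)‖ ^ 2 ≤
      (‖q.valueAt T‖ ^ 2 + ‖w‖ ^ 2) * Real.exp (4 / ν * ‖y‖ ^ 2 + 4 * ‖ρ‖ ^ 2) := by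
  have hcoeff_le : ∫ r in s..T, energyCoeff ν y ρ r ≤ 4 / ν * ‖y‖ ^ 2 + 4 * ‖ρ‖ ^ 2 := by
    rw [← integral_energyCoeff, intervalIntegral.integral_of_le hs.2, integral_Ioc_eq_integral_Ioo]
    exact setIntegral_mono_set (integrable_energyCoeff ν y ρ)
      (Eventually.of_forall (energyCoeff_nonneg hν y ρ))
      (LE.le.eventuallyLE (Ioo_subset_Ioo_left hs.1))
  refine (h.normSq_valueAt_add_le hν hT hs).trans ((gronwall_backward hs.2
    (intervalIntegrable_of_integrableOn_Ioo (integrable_energyCoeff ν y ρ) hs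
      (right_mem_Icc.2 hT.le)) (q.intervalIntegrable_energyCoeff_mul hT ν y ρ hs)
    (energyCoeff_nonneg hν y ρ) fun r hr => ?_).trans (by gcongr))
  have hdissipation : 0 ≤ ν * ∫ τ in r..T, ‖V.dx (q.toL2V τ)‖ ^ 2 :=
    mul_nonneg hν.le (intervalIntegral.integral_nonneg hr.2 fun τ _ => by positivity)
  linarith [h.normSq_valueAt_add_le hν hT ⟨hs.1.trans hr.1, hr.2⟩]

theorem normSq_toL2V_le (h : SolvesAdjointEq ν y w ρ q) (hν : 0 < ν) (hT : 0 < T) :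
    ‖q.toL2V‖ ^ 2 ≤ (T + 1 / ν) *
      ((‖q.valueAt T‖ ^ 2 + ‖w‖ ^ 2) * Real.exp (4 / ν * ‖y‖ ^ 2 + 4 * ‖ρ‖ ^ 2)) := by
  set B := (‖q.valueAt T‖ ^ 2 + ‖w‖ ^ 2) * Real.exp (4 / ν * ‖y‖ ^ 2 + 4 * ‖ρ‖ ^ 2)
  have hval_integrable : Integrable (fun t => ‖V.val (q.toL2V t)‖ ^ 2) (timeMeasure T) :=
    (V.val.comp_memLp' (Lp.memLp q.toL2V)).integrable_norm_pow two_ne_zero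
  have hval : ∫ t in Ioo 0 T, ‖V.val (q.toL2V t)‖ ^ 2 ≤ T * B := by
    have hae : ∀ᵐ t ∂timeMeasure T, ‖V.val (q.toL2V t)‖ ^ 2 ≤ B := by
      filter_upwards [(q.isContRep_valueAt hT).2, ae_restrict_mem measurableSet_Ioo] with t ht htT
      rw [← ht]
      refine (le_add_of_nonneg_right (mul_nonneg hν.le ?_)).trans
        (h.energy_le hν hT (Ioo_subset_Icc_self htT))
      exact intervalIntegral.integral_nonneg htT.2.le fun r _ => by positivity
    refine (integral_mono_ae hval_integrable (integrable_const B) hae).trans_eq ?_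
    rw [setIntegral_const, Real.volume_real_Ioo_of_le hT.le, smul_eq_mul, sub_zero]
  have hdx : ∫ t in Ioo 0 T, ‖V.dx (q.toL2V t)‖ ^ 2 ≤ 1 / ν * B := by
    rw [div_mul_eq_mul_div, one_mul, le_div_iff₀' hν, ← integral_Ioc_eq_integral_Ioo,
      ← intervalIntegral.integral_of_le hT.le]
    exact (le_add_of_nonneg_left (sq_nonneg _)).trans
      (h.energy_le hν hT (left_mem_Icc.2 hT.le))
  rw [norm_sq_eq_integral]
  simp only [V.norm_sq_eq]
  rw [integral_add hval_integrable (integrable_norm_dx_sq q.toL2V), add_mul]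
  exact add_le_add hval hdx

end SolvesAdjointEq

end EnergyEstimate

namespace IsAdjointSolution

variable {ν T : ℝ} {y_d : H} {y y₁ y₂ p p₁ p₂ : W T}

theorem normSq_toL2V_le (h : IsAdjointSolution ν T y_d y p) (hν : 0 < ν) (hT : 0 < T) :
    ‖p.toL2V‖ ^ 2 ≤
      (T + 1 / ν) * (‖y_d - y.valueAt T‖ ^ 2 * Real.exp (4 / ν * ‖y.toL2V‖ ^ 2)) := by
  simpa only [h.valueAt_eq, norm_zero, ne_eq, OfNat.ofNat_ne_zero, not_false_eq_true, zero_pow,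
    mul_zero, add_zero] using h.solvesAdjointEq.normSq_toL2V_le hν hT

theorem normSq_toL2V_sub_le (h₁ : IsAdjointSolution ν T y_d y₁ p₁)
    (h₂ : IsAdjointSolution ν T y_d y₂ p₂) (hν : 0 < ν) (hT : 0 < T) :
    ‖p₁.toL2V - p₂.toL2V‖ ^ 2 ≤ (T + 1 / ν) *
      ((‖y₁.valueAt T - y₂.valueAt T‖ ^ 2 + ‖y₁.toL2V - y₂.toL2V‖ ^ 2) *
        Real.exp (4 / ν * ‖y₁.toL2V‖ ^ 2 + 4 * ‖p₂.toL2V‖ ^ 2)) := by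
  have henergy := (h₁.solvesAdjointEq_sub h₂).normSq_toL2V_le hν hT
  rwa [W.valueAt_sub hT p₁ p₂ (right_mem_Icc.2 hT.le), h₁.valueAt_eq, h₂.valueAt_eq,
    sub_sub_sub_cancel_left, norm_sub_rev, W.toL2V_sub] at henergy

end IsAdjointSolution

end BurgersAdjoint

end

open BurgersAdjoint in
theorem mainTheorem9_general (ν T : ℝ) (hν : 0 < ν) (hT : 0 < T) (y_d : H) (R : ℝ) :
    ∃ C : ℝ, 0 ≤ C ∧ ∀ y₁ y₂ p₁ p₂ : W T,
      ‖y₁.toL2V‖ ≤ R → ‖y₂.toL2V‖ ≤ R → ‖y₂.valueAt T‖ ≤ R →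
      IsAdjointSolution ν T y_d y₁ p₁ → IsAdjointSolution ν T y_d y₂ p₂ →
      ‖p₁.toL2V - p₂.toL2V‖ ≤
        C * (‖y₁.valueAt T - y₂.valueAt T‖ + ‖y₁.toL2V - y₂.toL2V‖) := by
  let P : ℝ := (T + 1 / ν) * ((‖y_d‖ + R) ^ 2 * Real.exp (4 / ν * R ^ 2))
  let K : ℝ := (T + 1 / ν) * Real.exp (4 / ν * R ^ 2 + 4 * P)
  refine ⟨√K, Real.sqrt_nonneg _, fun y₁ y₂ p₁ p₂ hy₁ hy₂ hy₂T h₁ h₂ => ?_⟩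
  have hp₂ : ‖p₂.toL2V‖ ^ 2 ≤ P := by
    refine (h₂.normSq_toL2V_le hν hT).trans ?_
    dsimp only [P]
    gcongr
    exact (norm_sub_le _ _).trans (by gcongr)
  refine le_of_sq_le_sq ?_ (by positivity)
  rw [mul_pow, Real.sq_sqrt (by positivity)]
  calc ‖p₁.toL2V - p₂.toL2V‖ ^ 2
      ≤ (T + 1 / ν) * ((‖y₁.valueAt T - y₂.valueAt T‖ ^ 2 + ‖y₁.toL2V - y₂.toL2V‖ ^ 2) *
          Real.exp (4 / ν * ‖y₁.toL2V‖ ^ 2 + 4 * ‖p₂.toL2V‖ ^ 2)) :=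
        h₁.normSq_toL2V_sub_le h₂ hν hT
    _ ≤ (T + 1 / ν) * ((‖y₁.valueAt T - y₂.valueAt T‖ + ‖y₁.toL2V - y₂.toL2V‖) ^ 2 *
          Real.exp (4 / ν * R ^ 2 + 4 * P)) := by
        gcongr
        exact pow_add_pow_le (norm_nonneg _) (norm_nonneg _) two_ne_zero
    _ = K * (‖y₁.valueAt T - y₂.valueAt T‖ + ‖y₁.toL2V - y₂.toL2V‖) ^ 2 := by ring

theorem mainTheorem9 (ν T : ℝ) (hν : 0 < ν) (hT : 0 < T) (y_d : BurgersAdjoint.H) (M : ℝ) :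
    ∃ C : ℝ, ∀ y₁ y₂ p₁ p₂ : BurgersAdjoint.W T,
      (y₁.normLinftyV ≤ ENNReal.ofReal M ∨ ‖y₁‖ ≤ M) →
      (y₂.normLinftyV ≤ ENNReal.ofReal M ∨ ‖y₂‖ ≤ M) →
      BurgersAdjoint.IsAdjointSolution ν T y_d y₁ p₁ →
      BurgersAdjoint.IsAdjointSolution ν T y_d y₂ p₂ →
      ‖p₁.toL2V - p₂.toL2V‖ ≤ C * ‖y₁ - y₂‖ := by
  obtain ⟨R, hR⟩ := BurgersAdjoint.W.exists_bound_toL2V_valueAt hT M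
  obtain ⟨C, hC, hlip⟩ := mainTheorem9_general ν T hν hT y_d R
  refine ⟨C * (√((1 + T) / T) + 1), fun y₁ y₂ p₁ p₂ hy₁ hy₂ h₁ h₂ => ?_⟩
  have htoL2V := (y₁ - y₂).norm_toL2V_le
  have hvalue := (y₁ - y₂).norm_valueAt_le hT
  rw [BurgersAdjoint.W.valueAt_sub hT y₁ y₂ (right_mem_Icc.2 hT.le)] at hvalue
  rw [mul_assoc, add_one_mul]
  exact (hlip y₁ y₂ p₁ p₂ (hR y₁ hy₁).1 (hR y₂ hy₂).1 (hR y₂ hy₂).2 h₁ h₂).trans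
    (mul_le_mul_of_nonneg_left (add_le_add hvalue htoL2V) hC)
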